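/- Let $k\ge 2$ and let $(F_k,g_F)$ be a nonempty $k$-dimensional pseudo-Riemannian manifold that is Einstein with constant $\nu\in\mathbb R$, i.e. $\mathrm{Ric}_{g_F}=\nu\, g_F$. Let $J\subseteq\mathbb R_+=(0,\infty)$ be a nonempty open interval (for instance $J=\mathbb R_+$), let $u:J\to(0,\infty)$ be smooth, and put $J^2=\{r^2: r\in J\}$ (so $J^2=\mathbb R_+$ if $J=\mathbb R_+$). For either choice of the sign $\pm$ consider on $J^2\times\mathbb R\times F_k$, with coordinates $(s,y)\in J^2\times\mathbb R$, the pseudo-Riemannian metric $$g=s^{\frac1k-1}\Big[\frac{1}{4\sqrt s\,u^2(\sqrt s)}\,ds^2\pm 4\sqrt s\,u^2(\sqrt s)\,dy^2\Big]+s^{\frac2k}g_F .$$ (1) For every $\lambda\in\mathbb R$, $g$ is Einstein with constant $\lambda$ (that is, $\mathrm{Ric}_g=\lambda g$) if and only if there is a constant $C\in\mathbb R$ such that for all $r\in J$ $$u^2(r)=\lambda\Big(1-\big(1+\tfrac2k\big)^2\Big)^{-1}r^{1+\frac2k}+\nu\Big(1-\big(1-\tfrac2k\big)^2\Big)^{-1}r^{1-\frac2k}+\frac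 Cr .$$ (2) Let $k=2$, let $(F_2,g_F)$ be any pseudo-Riemannian manifold of dimension $2$ (not necessarily Einstein), let $J\subseteq\mathbb R_+$ be open and $u:J\to(0,\infty)$ smooth. The diffeomorphism $(r,t,x)\mapsto(s,y,x)=(r^2,t/2,x)$ from $J\times\mathbb R\times F_2$ onto $J^2\times\mathbb R\times F_2$ pulls $g$ back to $\dfrac{1}{u^2(r)}dr^2\pm u^2(r)\,dt^2+r^2g_F$. (3) The unit sphere $S^2\subset\mathbb R^3$ with its round metric $g_{S^2}$ is Einstein with constant $1$, and with $k=2$, $F=S^2$, $\nu=1$ the family contains: (a) the Schwarzschild metrics: for $M\ge 0$ (where $M=0$ gives the Minkowski metric), on $J=\{r>0:1-\frac{2M}r>0\}$, with the sign $-$, $\lambda=0$ and $C=-2M$, the formula in (1) reads $u^2(r)=1-\frac{2M}{r}$, $g$ is Einstein with constant $0$, and the diffeomorphism of (2) pulls $g$ back to $$-\Big(1-\frac{2M}{r}\Big)dt^2+\Big(1-\frac{2M}{r}\Big)^{-1}dr^2+r^2g_{S^2};$$ (b) the Riemannian Schwarzschild metrics (in the coordinates $(r,t)$, away from the zero of $u^2$):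 for $m>0$, on $J=\{r>0:1+r^2-\frac{2m}r>0\}$, with the sign $+$, $\lambda=-3$ and $C=-2m$, the formula in (1) reads $u^2(r)=1+r^2-\frac{2m}{r}$, $g$ is Einstein with constant $-3$, and the diffeomorphism of (2) pulls $g$ back to $$u^2\,dt^2+u^{-2}\,dr^2+r^2g_{S^2}.$$ -/

import Mathlib

set_option maxSynthPendingDepth 3
open Set
open scoped Manifold ContDiff

noncomputable section

section Curvature

variable {E : Type*} [NormedAddCommGroup E] [NormedSpace ℝ E]

/-- The Christoffel symbols of the first kind of a metric `G` with non-constant coefficients on a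
vector space, as the trilinear form `(v, w, x) ↦ ½ (∂_v G(w, x) + ∂_w G(v, x) - ∂_x G(v, w))`. -/
def christoffelFirst (G : E → E →L[ℝ] E →L[ℝ] ℝ) (z : E) : E →L[ℝ] E →L[ℝ] E →L[ℝ] ℝ :=
  let D : E →L[ℝ] E →L[ℝ] E →L[ℝ] ℝ := fderiv ℝ G z
  let swap : (E →L[ℝ] E →L[ℝ] ℝ) →L[ℝ] E →L[ℝ] E →L[ℝ] ℝ :=
    (ContinuousLinearMap.flipₗᵢ ℝ E E ℝ).toContinuousLinearEquiv
  (2⁻¹ : ℝ) • (D + D.flip - swap.comp D.flip)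

theorem christoffelFirst_apply (G : E → E →L[ℝ] E →L[ℝ] ℝ) (z v w x : E) :
    christoffelFirst G z v w x =
      2⁻¹ * (fderiv ℝ G z v w x + fderiv ℝ G z w v x - fderiv ℝ G z x v w) := rfl

/-- The Christoffel symbols `Γ(v, w) = ∇_v w` (`v`, `w` constant vector fields) of the Levi-Civita
connection of `G`: the first kind symbols with the last index raised by the inverse of
`G z : E → E*`, so that `G(Γ(v, w), x) = christoffelFirst G z v w x` for nondegenerate `G z`. -/
def christoffel (G : E → E →L[ℝ] E →L[ℝ] ℝ) (z : E) : E →L[ℝ] E →L[ℝ] E :=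
  (ContinuousLinearMap.compL ℝ E (E →L[ℝ] ℝ) E (ContinuousLinearMap.inverse (G z))).comp
    (christoffelFirst G z)

theorem christoffel_apply (G : E → E →L[ℝ] E →L[ℝ] ℝ) (z v w : E) :
    christoffel G z v w = ContinuousLinearMap.inverse (G z) (christoffelFirst G z v w) := rfl

/-- For fixed `w`, `x`, the linear map `v ↦ R(v, w) x = ∇_v ∇_w x - ∇_w ∇_v x` (`v`, `w`, `x`
constant vector fields), `R` the Riemann curvature of `G`. -/
def curvatureMap (G : E → E →L[ℝ] E →L[ℝ] ℝ) (z w x : E) : E →L[ℝ] E :=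
  ((fderiv ℝ (christoffel G) z).flip w).flip x - (fderiv ℝ (christoffel G) z w).flip x
    + (christoffel G z).flip (christoffel G z w x)
    - (christoffel G z w).comp ((christoffel G z).flip x)

theorem curvatureMap_apply (G : E → E →L[ℝ] E →L[ℝ] ℝ) (z v w x : E) :
    curvatureMap G z w x v =
      fderiv ℝ (christoffel G) z v w x - fderiv ℝ (christoffel G) z w v x
        + christoffel G z v (christoffel G z w x) - christoffel G z w (christoffel G z v x) := rfl

/-- The Ricci curvature in coordinates, `Ric(w, x) = trace (v ↦ R(v, w) x)`. -/
def coordRicci (G : E → E →L[ℝ] E →L[ℝ] ℝ) (z w x : E) : ℝ :=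
  LinearMap.trace ℝ E (curvatureMap G z w x : E →ₗ[ℝ] E)

end Curvature

section Manifold

variable {E : Type*} [NormedAddCommGroup E] [NormedSpace ℝ E] {H : Type*} [TopologicalSpace H]
  (I : ModelWithCorners ℝ E H) {M : Type*} [TopologicalSpace M] [ChartedSpace H M]
  {E' : Type*} [NormedAddCommGroup E'] [NormedSpace ℝ E'] {H' : Type*} [TopologicalSpace H']
  (I' : ModelWithCorners ℝ E' H') {N : Type*} [TopologicalSpace N] [ChartedSpace H' N]

variable (M) in
/-- A field of bilinear forms on the tangent spaces of `M`. -/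
abbrev BilinField := ∀ p : M, TangentSpace I p →L[ℝ] TangentSpace I p →L[ℝ] ℝ

/-- The pull-back `(Φ^* g)_p (v, w) = g_{Φ p} (dΦ_p v, dΦ_p w)`. -/
def pullbackField (Φ : M → N) (g : BilinField I' N) : BilinField I M := fun p =>
  ContinuousLinearMap.bilinearComp (E := E') (F := E') (E' := E) (F' := E)
    (g (Φ p)) (mfderiv I I' Φ p) (mfderiv I I' Φ p)

/-- The expression of `g` in the preferred chart at `p`: at a point `z` of the target of the chart
`φ` at `p`, the bilinear form `(v, w) ↦ g (d(φ⁻¹)_z v, d(φ⁻¹)_z w)`. -/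
def coordForm (g : BilinField I M) (p : M) : E → E →L[ℝ] E →L[ℝ] ℝ :=
  pullbackField 𝓘(ℝ, E) I (extChartAt I p).symm g

/-- `g` is a (smooth) pseudo-Riemannian metric on the manifold without boundary `M`: symmetric,
nondegenerate, and with smooth coefficients in the charts. -/
structure IsPseudoRiemannian (g : BilinField I M) : Prop where
  symm : ∀ p v w, g p v w = g p w v
  nondegenerate : ∀ p v, (∀ w, g p v w = 0) → v = 0
  smooth : ∀ p, ContDiffOn ℝ ∞ (coordForm I g p) (extChartAt I p).target

/-- The Ricci tensor of `g` at `p`, computed in the preferred chart at `p` (through which the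
tangent space at `p` is identified with the model space `E`). -/
def ricci (g : BilinField I M) (p : M) (v w : TangentSpace I p) : ℝ :=
  coordRicci (coordForm I g p) (extChartAt I p p) v w

/-- `(M, g)` is a pseudo-Riemannian Einstein manifold with constant `c`: `Ric = c g`. -/
def IsEinstein (g : BilinField I M) (c : ℝ) : Prop :=
  IsPseudoRiemannian I g ∧ ∀ p v w, ricci I g p v w = c * g p v w

end Manifold

section Schwarzschild

/-- The bilinear form `a ds² + b dy² + c h` on `ℝ × ℝ × E`. -/
def warpedForm {E : Type*} [NormedAddCommGroup E] [NormedSpace ℝ E] (a b c : ℝ)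
    (h : E →L[ℝ] E →L[ℝ] ℝ) : (ℝ × ℝ × E) →L[ℝ] (ℝ × ℝ × E) →L[ℝ] ℝ :=
  let ds : (ℝ × ℝ × E) →L[ℝ] ℝ := ContinuousLinearMap.fst ℝ ℝ (ℝ × E)
  let tail : (ℝ × ℝ × E) →L[ℝ] ℝ × E := ContinuousLinearMap.snd ℝ ℝ (ℝ × E)
  let dy : (ℝ × ℝ × E) →L[ℝ] ℝ := (ContinuousLinearMap.fst ℝ ℝ E).comp tail
  let dx : (ℝ × ℝ × E) →L[ℝ] E := (ContinuousLinearMap.snd ℝ ℝ E).comp tail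
  a • ds.smulRight ds + b • dy.smulRight dy + c • h.bilinearComp dx dx

theorem warpedForm_apply {E : Type*} [NormedAddCommGroup E] [NormedSpace ℝ E] (a b c : ℝ)
    (h : E →L[ℝ] E →L[ℝ] ℝ) (v w : ℝ × ℝ × E) :
    warpedForm a b c h v w =
      a * (v.1 * w.1) + b * (v.2.1 * w.2.1) + c * h v.2.2 w.2.2 := by
  simp [warpedForm]

/-- The model with corners of `J × ℝ × F`, `J ⊆ ℝ` open and `F` a `k`-dimensional manifold. -/
abbrev prodModel (k : ℕ) := 𝓘(ℝ, ℝ).prod (𝓘(ℝ, ℝ).prod (𝓡 k))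

/-- The range of `s = r²` (`r > 0`) when `r` ranges over `J`. -/
def sDomain (J : TopologicalSpace.Opens ℝ) : TopologicalSpace.Opens ℝ where
  carrier := {s | 0 < s ∧ √s ∈ J}
  is_open' := isOpen_Ioi.inter (J.isOpen.preimage Real.continuous_sqrt)

theorem sDomain_Ioi : sDomain ⟨Ioi 0, isOpen_Ioi⟩ = ⟨Ioi 0, isOpen_Ioi⟩ := by
  ext s
  change (0 < s ∧ 0 < √s) ↔ 0 < s
  simp

variable {k : ℕ} {F : Type*} [TopologicalSpace F] [ChartedSpace (EuclideanSpace ℝ (Fin k)) F]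

/-- The metric `s^(1/k-1) [ds² / (4 √s u²(√s)) + ε 4 √s u²(√s) dy²] + s^(2/k) g_F` on the set of
all `(s, y, x)` in `ℝ₊ × ℝ × F` with `√s ∈ J`. -/
def generalizedSchwarzschild (J : TopologicalSpace.Opens ℝ) (ε : ℝ) (u : ℝ → ℝ)
    (gF : BilinField (𝓡 k) F) : BilinField (prodModel k) (sDomain J × ℝ × F) := fun p =>
  let s : ℝ := p.1
  warpedForm (E := EuclideanSpace ℝ (Fin k))
    (s ^ (1 / (k : ℝ) - 1) * (1 / (4 * √s * u √s ^ 2)))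
    (s ^ (1 / (k : ℝ) - 1) * (ε * (4 * √s * u √s ^ 2)))
    (s ^ (2 / (k : ℝ)))
    (gF p.2.2)

/-- The metric `(1 / f(r)) dr² + ε f(r) dt² + r² g_F` on `J × ℝ × F`. -/
def arealMetric (J : TopologicalSpace.Opens ℝ) (ε : ℝ) (f : ℝ → ℝ)
    (gF : BilinField (𝓡 k) F) : BilinField (prodModel k) (J × ℝ × F) := fun p =>
  let r : ℝ := p.1
  warpedForm (E := EuclideanSpace ℝ (Fin k)) (1 / f r) (ε * f r) (r ^ 2) (gF p.2.2)

/-- The unit sphere `S²` in `ℝ³`. -/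
abbrev UnitSphere : Type := Metric.sphere (0 : EuclideanSpace ℝ (Fin 3)) 1

/-- The round metric of `S²`, induced by the Euclidean inner product of `ℝ³`. -/
def roundMetric : BilinField (𝓡 2) UnitSphere :=
  pullbackField (𝓡 2) 𝓘(ℝ, EuclideanSpace ℝ (Fin 3)) (fun x : UnitSphere => x.1)
    (fun _ => innerSL ℝ (E := EuclideanSpace ℝ (Fin 3)))

/-- The exterior region of the Schwarzschild metric: all `r > 0` with `1 - 2M/r > 0`. -/
def schwarzschildDomain (M : ℝ) : TopologicalSpace.Opens ℝ where
  carrier := {r | 0 < r ∧ 0 < 1 - 2 * M / r}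
  is_open' := by
    have h : ContinuousOn (fun r : ℝ => 1 - 2 * M / r) (Ioi 0) :=
      continuousOn_const.sub (continuousOn_const.div continuousOn_id fun r hr => ne_of_gt hr)
    exact h.isOpen_inter_preimage isOpen_Ioi isOpen_Ioi

/-- The Schwarzschild metric `-(1 - 2M/r) dt² + dr² / (1 - 2M/r) + r² g_{S²}`. -/
def schwarzschildMetric (M : ℝ) :
    BilinField (prodModel 2) (schwarzschildDomain M × ℝ × UnitSphere) :=
  arealMetric (schwarzschildDomain M) (-1) (fun r => 1 - 2 * M / r) roundMetric

/-- All `r > 0` with `1 + r² - 2m/r > 0`. -/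
def riemannianSchwarzschildDomain (m : ℝ) : TopologicalSpace.Opens ℝ where
  carrier := {r | 0 < r ∧ 0 < 1 + r ^ 2 - 2 * m / r}
  is_open' := by
    have h : ContinuousOn (fun r : ℝ => 1 + r ^ 2 - 2 * m / r) (Ioi 0) :=
      (continuousOn_const.add (continuousOn_id.pow 2)).sub
        (continuousOn_const.div continuousOn_id fun r hr => ne_of_gt hr)
    exact h.isOpen_inter_preimage isOpen_Ioi isOpen_Ioi

/-- The Riemannian Schwarzschild metric `V dt² + V⁻¹ dr² + r² g_{S²}`, `V = 1 + r² - 2m/r`. -/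
def riemannianSchwarzschildMetric (m : ℝ) :
    BilinField (prodModel 2) (riemannianSchwarzschildDomain m × ℝ × UnitSphere) :=
  arealMetric (riemannianSchwarzschildDomain m) 1 (fun r => 1 + r ^ 2 - 2 * m / r) roundMetric

/-- The right-hand side
`lam (1 - (1 + 2/k)²)⁻¹ r^(1 + 2/k) + ν (1 - (1 - 2/k)²)⁻¹ r^(1 - 2/k) + C / r`. -/
def profile (k : ℕ) (lam ν C r : ℝ) : ℝ :=
  lam * (1 - (1 + 2 / (k : ℝ)) ^ 2)⁻¹ * r ^ (1 + 2 / (k : ℝ))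
    + ν * (1 - (1 - 2 / (k : ℝ)) ^ 2)⁻¹ * r ^ (1 - 2 / (k : ℝ)) + C / r

end Schwarzschild

end

/-! Put `f s = 4 √s u²(√s)`. The metric is then a doubly warped one, `a ds² + b dy² + c g_F`, with
`a = s^(1/k-1) / f`, `b = ε s^(1/k-1) f` and `c = s^(2/k)`. Its Christoffel symbols involve only
those of `g_F` and the logarithmic derivatives of `a`, `b`, `c`, so the Ricci tensor splits into
`Ric_{g_F}` plus multiples of `ds²`, `dy²` and `g_F` (`coordRicci_warpedMetric`). With these
coefficients the formula collapses (`coordRicci_schwarzschildCoordMetric`): the `ds²` and `dy²`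
parts both contain the same expression `f'' + f'/(ks)`, and the fibre part is `Ric_{g_F} - (1/k)
s^(1/k) f' g_F`.

Hence `Ric = λ g` means two equations. The fibre equation is the linear first-order equation `f' =
kν s^(-1/k) - kλ s^(1/k)`; differentiating it yields the other one, `f'' + f'/(ks) = -2λ s^(1/k-1)`
(`deriv_deriv_of_deriv`). Integrating on the connected `J` and substituting `s = r²`, `f = 4 r u²`
gives the stated formula, with integration constant `4C`.

These computations live in coordinates. `coordForm_warpedForm` carries them to the manifold: the
preferred charts of the product are products of charts, so the metric is again warped there, over
the chart expression of `g_F`.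

For `k = 2` the pull-back uses only `ds = 2r dr` and `dy = dt/2`. The round sphere is treated in
stereographic coordinates, centred so that the curvature is needed only at the origin, where the
Christoffel symbols vanish (`isEinstein_roundMetric`). The two Schwarzschild families are then
special cases with `u = √f`, `f` now denoting the desired value of `u²`. -/

noncomputable section

/-! ### Christoffel symbols and Ricci curvature in coordinates: locality, symmetry, smoothness. -/

section CoordinateCalculus

open Filter Topology

variable {E : Type*} [NormedAddCommGroup E] [NormedSpace ℝ E]

theorem christoffelFirst_congr {G G' : E → E →L[ℝ] E →L[ℝ] ℝ} {z : E} (h : G =ᶠ[𝓝 z] G') :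
    christoffelFirst G z = christoffelFirst G' z := by
  simp only [christoffelFirst, h.fderiv_eq]

theorem christoffel_congr {G G' : E → E →L[ℝ] E →L[ℝ] ℝ} {z : E} (h : G =ᶠ[𝓝 z] G') :
    christoffel G z = christoffel G' z := by
  simp only [christoffel, christoffelFirst_congr h, h.eq_of_nhds]

theorem christoffel_eventuallyEq {G G' : E → E →L[ℝ] E →L[ℝ] ℝ} {z : E} (h : G =ᶠ[𝓝 z] G') :
    christoffel G =ᶠ[𝓝 z] christoffel G' :=
  h.eventuallyEq_nhds.mono fun _ hy => christoffel_congr hy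

/-- Ricci curvature depends only on the germ of the metric. Chart expressions are known only on the
chart target, so this is what permits replacing them by explicit formulas. -/
theorem coordRicci_congr {G G' : E → E →L[ℝ] E →L[ℝ] ℝ} {z : E} (h : G =ᶠ[𝓝 z] G') :
    coordRicci G z = coordRicci G' z := by
  funext w x
  simp only [coordRicci, curvatureMap, christoffel_congr h,
    (christoffel_eventuallyEq h).fderiv_eq]

theorem apply_christoffel {G : E → E →L[ℝ] E →L[ℝ] ℝ} {z : E} (hG : (G z).IsInvertible)
    (v w x : E) : G z (christoffel G z v w) x = christoffelFirst G z v w x := by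
  obtain ⟨e, he⟩ := hG
  rw [christoffel_apply, ← he, ContinuousLinearMap.inverse_equiv]
  simp

theorem fderiv_clm_apply_apply {D F₁ F₂ : Type*} [NormedAddCommGroup D] [NormedSpace ℝ D]
    [NormedAddCommGroup F₁] [NormedSpace ℝ F₁] [NormedAddCommGroup F₂] [NormedSpace ℝ F₂]
    {T : D → F₁ →L[ℝ] F₂} {z : D} (hT : DifferentiableAt ℝ T z) (v : D) (w : F₁) :
    fderiv ℝ T z v w = fderiv ℝ (fun z => T z w) z v := by
  rw [fderiv_clm_apply hT (differentiableAt_const w)]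
  simp

theorem fderiv_clm_apply_apply₂ {D F₁ F₂ F₃ : Type*} [NormedAddCommGroup D] [NormedSpace ℝ D]
    [NormedAddCommGroup F₁] [NormedSpace ℝ F₁] [NormedAddCommGroup F₂] [NormedSpace ℝ F₂]
    [NormedAddCommGroup F₃] [NormedSpace ℝ F₃]
    {T : D → F₁ →L[ℝ] F₂ →L[ℝ] F₃} {z : D} (hT : DifferentiableAt ℝ T z) (v : D) (w : F₁)
    (x : F₂) :
    fderiv ℝ T z v w x = fderiv ℝ (fun z => T z w x) z v := by
  rw [fderiv_clm_apply_apply hT, fderiv_clm_apply_apply (hT.clm_apply (differentiableAt_const w))]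

theorem christoffel_symm {G : E → E →L[ℝ] E →L[ℝ] ℝ} {z : E} (hd : DifferentiableAt ℝ G z)
    (hG : ∀ᶠ z in 𝓝 z, ∀ v w, G z v w = G z w v) (v w : E) :
    christoffel G z v w = christoffel G z w v := by
  rw [christoffel_apply, christoffel_apply]
  congr 1
  ext x
  have h3 : ∀ v w x : E, fderiv ℝ G z v w x = fderiv ℝ G z v x w := fun v w x => by
    rw [fderiv_clm_apply_apply₂ hd, fderiv_clm_apply_apply₂ hd]
    have : (fun z => G z w x) =ᶠ[𝓝 z] fun z => G z x w := hG.mono fun z hz => hz w x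
    rw [this.fderiv_eq]
  rw [christoffelFirst_apply, christoffelFirst_apply, h3 x v w]
  ring

variable [FiniteDimensional ℝ E]

theorem isInvertible_of_nondegenerate {B : E →L[ℝ] E →L[ℝ] ℝ}
    (hB : ∀ v, (∀ w, B v w = 0) → v = 0) : B.IsInvertible := by
  have hinj : Function.Injective (B : E →ₗ[ℝ] E →L[ℝ] ℝ) := by
    rw [← LinearMap.ker_eq_bot, LinearMap.ker_eq_bot']
    intro v hv
    exact hB v fun w => by
      have := congrArg (fun L : E →L[ℝ] ℝ => L w) hv
      simpa using this
  have hdim : Module.finrank ℝ E = Module.finrank ℝ (E →L[ℝ] ℝ) := by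
    rw [← (LinearMap.toContinuousLinearMap : (E →ₗ[ℝ] ℝ) ≃ₗ[ℝ] (E →L[ℝ] ℝ)).finrank_eq]
    exact Subspace.dual_finrank_eq.symm
  refine ⟨(LinearMap.linearEquivOfInjective (B : E →ₗ[ℝ] E →L[ℝ] ℝ) hinj
    hdim).toContinuousLinearEquiv, ?_⟩
  ext v w
  rfl

/-- A guessed Christoffel symbol is checked with its last index lowered, so no inverse metric is
ever computed. -/
theorem christoffel_eq_of_forall {G : E → E →L[ℝ] E →L[ℝ] ℝ} {z : E}
    (hG : ∀ v, (∀ w, G z v w = 0) → v = 0) {v w V : E}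
    (hV : ∀ x, G z V x = christoffelFirst G z v w x) : christoffel G z v w = V := by
  refine sub_eq_zero.1 (hG _ fun x => ?_)
  simp [apply_christoffel (isInvertible_of_nondegenerate hG), hV]

/-- A basis of the finite-dimensional source identifies the space of linear maps with a finite power
of `F`, where smoothness is componentwise. -/
theorem contDiffAt_clm_of_forall {D F : Type*} [NormedAddCommGroup D] [NormedSpace ℝ D]
    [NormedAddCommGroup F] [NormedSpace ℝ F] {n : ℕ∞ω} {f : D → E →L[ℝ] F} {x : D}
    (h : ∀ y, ContDiffAt ℝ n (fun z => f z y) x) : ContDiffAt ℝ n f x := by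
  let d := Module.finrank ℝ E
  have hd : d = Module.finrank ℝ (Fin d → ℝ) := (Module.finrank_fin_fun ℝ).symm
  let e₁ := ContinuousLinearEquiv.ofFinrankEq hd
  let e₂ := (e₁.arrowCongr (1 : F ≃L[ℝ] F)).trans (ContinuousLinearEquiv.piRing (Fin d))
  rw [← Function.id_comp f, ← e₂.symm_comp_self]
  exact e₂.symm.contDiff.contDiffAt.comp x (contDiffAt_pi.mpr fun i => h _)

theorem contDiffAt_christoffelFirst {G : E → E →L[ℝ] E →L[ℝ] ℝ} {z : E}
    (hG : ContDiffAt ℝ ∞ G z) : ContDiffAt ℝ ∞ (christoffelFirst G) z := by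
  have hD : ContDiffAt ℝ ∞ (fderiv ℝ G) z := hG.fderiv_right (by simp)
  refine contDiffAt_clm_of_forall fun v => contDiffAt_clm_of_forall fun w =>
    contDiffAt_clm_of_forall fun x => ?_
  simp only [christoffelFirst_apply]
  have h3 : ∀ v w x : E, ContDiffAt ℝ ∞ (fun z => fderiv ℝ G z v w x) z := fun v w x =>
    ((hD.clm_apply contDiffAt_const).clm_apply contDiffAt_const).clm_apply contDiffAt_const
  exact contDiffAt_const.mul (((h3 v w x).add (h3 w v x)).sub (h3 x v w))

theorem contDiffAt_christoffel {G : E → E →L[ℝ] E →L[ℝ] ℝ} {z : E}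
    (hG : ContDiffAt ℝ ∞ G z) (hz : (G z).IsInvertible) :
    ContDiffAt ℝ ∞ (christoffel G) z := by
  have := FiniteDimensional.complete ℝ E
  refine contDiffAt_clm_of_forall fun v => contDiffAt_clm_of_forall fun w => ?_
  simp only [christoffel_apply]
  refine ContDiffAt.clm_apply (f := fun z => ContinuousLinearMap.inverse (G z))
    (hz.contDiffAt_map_inverse.comp z hG) ?_
  exact ((contDiffAt_christoffelFirst hG).clm_apply contDiffAt_const).clm_apply contDiffAt_const

end CoordinateCalculus

/-! ### Traces of block maps. -/

section Trace

theorem trace_prod_eq {R V W : Type*} [Field R] [AddCommGroup V] [Module R V] [AddCommGroup W]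
    [Module R W] [FiniteDimensional R V] [FiniteDimensional R W] (L : V × W →ₗ[R] V × W) :
    LinearMap.trace R (V × W) L =
      LinearMap.trace R V (LinearMap.fst R V W ∘ₗ L ∘ₗ LinearMap.inl R V W) +
        LinearMap.trace R W (LinearMap.snd R V W ∘ₗ L ∘ₗ LinearMap.inr R V W) := by
  have h : L = (L ∘ₗ LinearMap.inl R V W) ∘ₗ LinearMap.fst R V W +
      (L ∘ₗ LinearMap.inr R V W) ∘ₗ LinearMap.snd R V W := by
    exact LinearMap.ext fun v => by simp [← map_add]
  conv_lhs => rw [h, map_add]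
  rw [LinearMap.trace_comp_comm', LinearMap.trace_comp_comm' _ (L ∘ₗ LinearMap.inr R V W)]

theorem trace_eq_apply_one (L : ℝ →ₗ[ℝ] ℝ) : LinearMap.trace ℝ ℝ L = L 1 := by
  have h : L = (LinearMap.id : ℝ →ₗ[ℝ] ℝ).smulRight (L 1) := by ext; simp
  conv_lhs => rw [h]
  rw [LinearMap.trace_smulRight]
  rfl

end Trace

/-! ### Curvature of doubly warped metrics. -/

section Warped

open Filter Topology

variable {E : Type*} [NormedAddCommGroup E] [NormedSpace ℝ E]

/-- The metric `a(s) ds² + b(s) dy² + c(s) h` on an open part of `ℝ × ℝ × E`. -/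
def warpedMetric (a b c : ℝ → ℝ) (h : E → E →L[ℝ] E →L[ℝ] ℝ) :
    ℝ × ℝ × E → (ℝ × ℝ × E) →L[ℝ] (ℝ × ℝ × E) →L[ℝ] ℝ := fun z =>
  warpedForm (a z.1) (b z.1) (c z.1) (h z.2.2)

theorem warpedForm_nondegenerate {a b c : ℝ} {h : E →L[ℝ] E →L[ℝ] ℝ} (ha : a ≠ 0) (hb : b ≠ 0)
    (hc : c ≠ 0) (hh : ∀ v, (∀ w, h v w = 0) → v = 0) (v : ℝ × ℝ × E)
    (hv : ∀ w, warpedForm a b c h v w = 0) : v = 0 := by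
  simp only [warpedForm_apply] at hv
  have h1 : v.1 = 0 := by simpa [ha] using hv (1, 0, 0)
  have h2 : v.2.1 = 0 := by simpa [hb] using hv (0, 1, 0)
  have h3 : v.2.2 = 0 := hh _ fun w => by simpa [hc] using hv (0, 0, w)
  exact Prod.ext h1 (Prod.ext h2 h3)

/-- The coefficients `A, B, C, β, γ` of the Christoffel symbols of the metric
`a ds² + b dy² + c h`. -/
structure IsWarpedConnection (a b c A B C β γ : ℝ → ℝ) (s : ℝ) : Prop where
  a_ne : a s ≠ 0
  b_ne : b s ≠ 0
  c_ne : c s ≠ 0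
  contDiffAt_a : ContDiffAt ℝ ∞ a s
  contDiffAt_b : ContDiffAt ℝ ∞ b s
  contDiffAt_c : ContDiffAt ℝ ∞ c s
  hasDerivAt_a : HasDerivAt a (2 * a s * A s) s
  hasDerivAt_b : HasDerivAt b (2 * b s * β s) s
  hasDerivAt_c : HasDerivAt c (2 * c s * γ s) s
  mul_B : a s * B s = b s * β s
  mul_C : a s * C s = c s * γ s

variable [FiniteDimensional ℝ E]

theorem contDiffAt_warpedMetric {a b c : ℝ → ℝ} {h : E → E →L[ℝ] E →L[ℝ] ℝ} {z : ℝ × ℝ × E}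
    (ha : ContDiffAt ℝ ∞ a z.1) (hb : ContDiffAt ℝ ∞ b z.1) (hc : ContDiffAt ℝ ∞ c z.1)
    (hh : ContDiffAt ℝ ∞ h z.2.2) : ContDiffAt ℝ ∞ (warpedMetric a b c h) z := by
  refine contDiffAt_clm_of_forall fun v => contDiffAt_clm_of_forall fun w => ?_
  simp only [warpedMetric, warpedForm_apply]
  have h1 : ContDiffAt ℝ ∞ (fun z : ℝ × ℝ × E => z.1) z := contDiffAt_fst
  have h2 : ContDiffAt ℝ ∞ (fun z : ℝ × ℝ × E => z.2.2) z := contDiffAt_snd.comp z contDiffAt_snd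
  exact (((ha.comp z h1).mul contDiffAt_const).add ((hb.comp z h1).mul contDiffAt_const)).add
    ((hc.comp z h1).mul (((hh.comp z h2).clm_apply contDiffAt_const).clm_apply contDiffAt_const))

theorem fderiv_warpedMetric {a b c : ℝ → ℝ} {h : E → E →L[ℝ] E →L[ℝ] ℝ} {z : ℝ × ℝ × E}
    {a' b' c' : ℝ} (ha : ContDiffAt ℝ ∞ a z.1) (hb : ContDiffAt ℝ ∞ b z.1)
    (hc : ContDiffAt ℝ ∞ c z.1) (hh : ContDiffAt ℝ ∞ h z.2.2) (ha' : HasDerivAt a a' z.1)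
    (hb' : HasDerivAt b b' z.1) (hc' : HasDerivAt c c' z.1) (v w x : ℝ × ℝ × E) :
    fderiv ℝ (warpedMetric a b c h) z v w x =
      a' * v.1 * (w.1 * x.1) + b' * v.1 * (w.2.1 * x.2.1) + c' * v.1 * h z.2.2 w.2.2 x.2.2
        + c z.1 * fderiv ℝ h z.2.2 v.2.2 w.2.2 x.2.2 := by
  rw [fderiv_clm_apply_apply₂
    ((contDiffAt_warpedMetric ha hb hc hh).differentiableAt (by simp))]
  simp only [warpedMetric, warpedForm_apply]
  have h1 : HasFDerivAt (fun z : ℝ × ℝ × E => z.1) (.fst ℝ ℝ (ℝ × E)) z := hasFDerivAt_fst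
  have h2 : HasFDerivAt (fun z : ℝ × ℝ × E => z.2.2)
      ((ContinuousLinearMap.snd ℝ ℝ E).comp (.snd ℝ ℝ (ℝ × E))) z :=
    hasFDerivAt_snd.comp z hasFDerivAt_snd
  have hhw : HasFDerivAt (fun y => h y w.2.2 x.2.2)
      (fderiv ℝ (fun y => h y w.2.2 x.2.2) z.2.2) z.2.2 :=
    (((hh.differentiableAt (by simp)).clm_apply (differentiableAt_const _)).clm_apply
      (differentiableAt_const _)).hasFDerivAt
  have key := (((ha'.hasFDerivAt.comp z h1).mul_const (w.1 * x.1)).add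
    ((hb'.hasFDerivAt.comp z h1).mul_const (w.2.1 * x.2.1))).add
    ((hc'.hasFDerivAt.comp z h1).mul (hhw.comp z h2))
  have key' := congrArg (fun L => L v) key.fderiv
  rw [fderiv_clm_apply_apply₂ (hh.differentiableAt (by simp))]
  refine Eq.trans ?_ (key'.trans ?_)
  · rfl
  · simp
    ring

/-- Here `A`, `β`, `γ` are half the logarithmic derivatives of `a`, `b`, `c`, while `B = b'/(2a)`
and `C = c'/(2a)`. They are kept as named functions, so that differentiating the symbols once more
never meets a quotient. -/
theorem christoffel_warpedMetric {a b c A B C β γ : ℝ → ℝ} {h : E → E →L[ℝ] E →L[ℝ] ℝ}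
    {z : ℝ × ℝ × E} (H : IsWarpedConnection a b c A B C β γ z.1)
    (hh : ContDiffAt ℝ ∞ h z.2.2) (hn : ∀ v, (∀ w, h z.2.2 v w = 0) → v = 0)
    (v w : ℝ × ℝ × E) :
    christoffel (warpedMetric a b c h) z v w =
      (A z.1 * (v.1 * w.1) - B z.1 * (v.2.1 * w.2.1) - C z.1 * h z.2.2 v.2.2 w.2.2,
        β z.1 * (v.1 * w.2.1 + w.1 * v.2.1),
        christoffel h z.2.2 v.2.2 w.2.2 + γ z.1 • (v.1 • w.2.2 + w.1 • v.2.2)) := by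
  refine christoffel_eq_of_forall
    (warpedForm_nondegenerate H.a_ne H.b_ne H.c_ne hn) fun x => ?_
  simp only [christoffelFirst_apply, fderiv_warpedMetric H.contDiffAt_a H.contDiffAt_b
    H.contDiffAt_c hh H.hasDerivAt_a H.hasDerivAt_b H.hasDerivAt_c]
  simp only [warpedMetric, warpedForm_apply, map_add, map_smul, add_apply,
    smul_apply, smul_eq_mul,
    apply_christoffel (isInvertible_of_nondegenerate hn), christoffelFirst_apply]
  have hB := H.mul_B
  have hC := H.mul_C
  linear_combination (-(v.2.1 * w.2.1) * x.1) * hB - (h z.2.2 v.2.2 w.2.2 * x.1) * hC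

theorem fderiv_christoffel_warpedMetric {a b c A B C β γ : ℝ → ℝ}
    {h : E → E →L[ℝ] E →L[ℝ] ℝ} {z : ℝ × ℝ × E} {A' B' C' β' γ' : ℝ}
    (H : ∀ᶠ s in 𝓝 z.1, IsWarpedConnection a b c A B C β γ s)
    (hev : ∀ᶠ y in 𝓝 z.2.2, ContDiffAt ℝ ∞ h y)
    (hn : ∀ᶠ y in 𝓝 z.2.2, ∀ v, (∀ w, h y v w = 0) → v = 0)
    (hA : HasDerivAt A A' z.1) (hB : HasDerivAt B B' z.1) (hC : HasDerivAt C C' z.1)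
    (hβ : HasDerivAt β β' z.1) (hγ : HasDerivAt γ γ' z.1) (v w x : ℝ × ℝ × E) :
    fderiv ℝ (christoffel (warpedMetric a b c h)) z v w x =
      (v.1 * (A' * (w.1 * x.1) - B' * (w.2.1 * x.2.1) - C' * h z.2.2 w.2.2 x.2.2)
          - C z.1 * fderiv ℝ h z.2.2 v.2.2 w.2.2 x.2.2,
        v.1 * β' * (w.1 * x.2.1 + x.1 * w.2.1),
        fderiv ℝ (christoffel h) z.2.2 v.2.2 w.2.2 x.2.2
          + (v.1 * γ') • (w.1 • x.2.2 + x.1 • w.2.2)) := by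
  have hh := hev.self_of_nhds
  have Hz := H.self_of_nhds
  have hnz := hn.self_of_nhds
  have h1 : HasFDerivAt (fun z : ℝ × ℝ × E => z.1) (.fst ℝ ℝ (ℝ × E)) z := hasFDerivAt_fst
  have h2 : HasFDerivAt (fun z : ℝ × ℝ × E => z.2.2)
      ((ContinuousLinearMap.snd ℝ ℝ E).comp (.snd ℝ ℝ (ℝ × E))) z :=
    hasFDerivAt_snd.comp z hasFDerivAt_snd
  have hdh := hh.differentiableAt (by simp)
  have hdΓ := (contDiffAt_christoffel hh (isInvertible_of_nondegenerate hnz)).differentiableAt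
    (by simp)
  have hG := contDiffAt_warpedMetric (z := z) Hz.contDiffAt_a Hz.contDiffAt_b Hz.contDiffAt_c hh
  rw [fderiv_clm_apply_apply₂ ((contDiffAt_christoffel hG (isInvertible_of_nondegenerate
    (warpedForm_nondegenerate Hz.a_ne Hz.b_ne Hz.c_ne hnz))).differentiableAt (by simp))]
  -- The closed form must hold on a whole neighbourhood of `z` to be differentiated, hence the
  -- eventual hypotheses.
  have heq : (fun z => christoffel (warpedMetric a b c h) z w x) =ᶠ[𝓝 z] fun z =>
      (A z.1 * (w.1 * x.1) - B z.1 * (w.2.1 * x.2.1) - C z.1 * h z.2.2 w.2.2 x.2.2,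
        β z.1 * (w.1 * x.2.1 + x.1 * w.2.1),
        christoffel h z.2.2 w.2.2 x.2.2 + γ z.1 • (w.1 • x.2.2 + x.1 • w.2.2)) := by
    filter_upwards [h1.continuousAt.eventually H, h2.continuousAt.eventually hn,
      h2.continuousAt.eventually hev] with y hy1 hy2 hy3
    exact christoffel_warpedMetric hy1 hy3 hy2 w x
  have hhw : HasFDerivAt (fun y => h y w.2.2 x.2.2)
      (fderiv ℝ (fun y => h y w.2.2 x.2.2) z.2.2) z.2.2 :=
    ((hdh.clm_apply (differentiableAt_const _)).clm_apply (differentiableAt_const _)).hasFDerivAt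
  have hΓw : HasFDerivAt (fun y => christoffel h y w.2.2 x.2.2)
      (fderiv ℝ (fun y => christoffel h y w.2.2 x.2.2) z.2.2) z.2.2 :=
    ((hdΓ.clm_apply (differentiableAt_const _)).clm_apply (differentiableAt_const _)).hasFDerivAt
  have key := ((((hA.hasFDerivAt.comp z h1).mul_const (w.1 * x.1)).sub
    ((hB.hasFDerivAt.comp z h1).mul_const (w.2.1 * x.2.1))).sub
    ((hC.hasFDerivAt.comp z h1).mul (hhw.comp z h2))).prodMk
    (((hβ.hasFDerivAt.comp z h1).mul_const (w.1 * x.2.1 + x.1 * w.2.1)).prodMk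
    ((hΓw.comp z h2).add
      ((hγ.hasFDerivAt.comp z h1).smul_const (w.1 • x.2.2 + x.1 • w.2.2))))
  rw [heq.fderiv_eq, fderiv_clm_apply_apply₂ hdh, fderiv_clm_apply_apply₂ hdΓ]
  refine (congrArg (fun L => L v) key.fderiv).trans ?_
  refine Prod.ext ?_ (Prod.ext ?_ ?_)
  · simp
    ring
  · simp
    ring
  · simp

/-- The trace of the curvature map is the sum of its diagonal blocks on `ℝ`, `ℝ` and `E`; only the
last one sees the curvature of `h`. -/
theorem coordRicci_warpedMetric {a b c A B C β γ : ℝ → ℝ}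
    {h : E → E →L[ℝ] E →L[ℝ] ℝ} {z : ℝ × ℝ × E} {A' B' C' β' γ' : ℝ}
    (H : ∀ᶠ s in 𝓝 z.1, IsWarpedConnection a b c A B C β γ s)
    (hev : ∀ᶠ y in 𝓝 z.2.2, ContDiffAt ℝ ∞ h y)
    (hn : ∀ᶠ y in 𝓝 z.2.2, ∀ v, (∀ w, h y v w = 0) → v = 0)
    (hs : ∀ᶠ y in 𝓝 z.2.2, ∀ v w, h y v w = h y w v)
    (hA : HasDerivAt A A' z.1) (hB : HasDerivAt B B' z.1) (hC : HasDerivAt C C' z.1)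
    (hβ : HasDerivAt β β' z.1) (hγ : HasDerivAt γ γ' z.1) (w x : ℝ × ℝ × E) :
    coordRicci (warpedMetric a b c h) z w x =
      coordRicci h z.2.2 w.2.2 x.2.2
        + (-β' + β z.1 * A z.1 - β z.1 ^ 2
            + Module.finrank ℝ E * (-γ' + γ z.1 * A z.1 - γ z.1 ^ 2)) * (w.1 * x.1)
        + (-B' - A z.1 * B z.1 + B z.1 * β z.1 - Module.finrank ℝ E * γ z.1 * B z.1)
            * (w.2.1 * x.2.1)
        + (-C' - A z.1 * C z.1 + (2 - Module.finrank ℝ E) * γ z.1 * C z.1 - β z.1 * C z.1)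
            * h z.2.2 w.2.2 x.2.2 := by
  have hh := hev.self_of_nhds
  have Hz := H.self_of_nhds
  have hnz := hn.self_of_nhds
  have hsym := christoffel_symm (hh.differentiableAt (by simp)) hs
  have hR : ∀ v, curvatureMap (warpedMetric a b c h) z w x v = _ := fun v => by
    rw [curvatureMap_apply, fderiv_christoffel_warpedMetric H hev hn hA hB hC hβ hγ,
      fderiv_christoffel_warpedMetric H hev hn hA hB hC hβ hγ]
  have hΓ := christoffel_warpedMetric Hz hh hnz
  rw [coordRicci, trace_prod_eq, trace_eq_apply_one, trace_prod_eq, trace_eq_apply_one]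
  -- The `E`-block is the curvature map of `h`, a multiple of the identity, and a rank-one map with
  -- trace `γ C h(w, x)`. The leftover `Γ_h(v, w) - Γ_h(w, v)` vanishes by symmetry.
  have hlast : LinearMap.snd ℝ ℝ E ∘ₗ (LinearMap.snd ℝ ℝ (ℝ × E) ∘ₗ
        (curvatureMap (warpedMetric a b c h) z w x : ℝ × ℝ × E →ₗ[ℝ] ℝ × ℝ × E) ∘ₗ
          LinearMap.inr ℝ ℝ (ℝ × E)) ∘ₗ LinearMap.inr ℝ ℝ E =
      (curvatureMap h z.2.2 w.2.2 x.2.2 : E →ₗ[ℝ] E)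
        + ((-γ' + γ z.1 * A z.1 - γ z.1 ^ 2) * (w.1 * x.1)
          - γ z.1 * B z.1 * (w.2.1 * x.2.1) - γ z.1 * C z.1 * h z.2.2 w.2.2 x.2.2)
            • LinearMap.id
        + (γ z.1 * C z.1) • ((h z.2.2).flip x.2.2 : E →ₗ[ℝ] ℝ).smulRight w.2.2 := by
    ext v
    simp [hR, hΓ, curvatureMap_apply, hsym v w.2.2]
    module
  rw [hlast]
  simp [hR, hΓ, coordRicci, LinearMap.trace_smulRight]
  ring

end Warped

/-! ### The warped metric with the generalized Schwarzschild coefficients. -/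

section SchwarzschildCoordinates

open Filter Topology

variable {E : Type*} [NormedAddCommGroup E] [NormedSpace ℝ E]

/-- The metric `s^(1/k-1) [ds² / f(s) + ε f(s) dy²] + s^(2/k) h` in coordinates. -/
def schwarzschildCoordMetric (k : ℕ) (ε : ℝ) (f : ℝ → ℝ) (h : E → E →L[ℝ] E →L[ℝ] ℝ) :
    ℝ × ℝ × E → (ℝ × ℝ × E) →L[ℝ] (ℝ × ℝ × E) →L[ℝ] ℝ :=
  warpedMetric (fun s => s ^ (1 / (k : ℝ) - 1) * (1 / f s))
    (fun s => s ^ (1 / (k : ℝ) - 1) * (ε * f s)) (fun s => s ^ (2 / (k : ℝ))) h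

theorem isWarpedConnection_schwarzschild {k : ℕ} (hk : k ≠ 0) {ε : ℝ} (hε : ε ≠ 0) {f : ℝ → ℝ}
    {s : ℝ} (hs : 0 < s) (hf : f s ≠ 0) (hfs : ContDiffAt ℝ ∞ f s) :
    IsWarpedConnection (fun s => s ^ (1 / (k : ℝ) - 1) * (1 / f s))
      (fun s => s ^ (1 / (k : ℝ) - 1) * (ε * f s)) (fun s => s ^ (2 / (k : ℝ)))
      (fun s => ((1 / (k : ℝ) - 1) / s - deriv f s / f s) / 2)
      (fun s => ε / 2 * ((1 / (k : ℝ) - 1) * f s ^ 2 / s + f s * deriv f s))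
      (fun s => 1 / (k : ℝ) * (s ^ (1 / (k : ℝ)) * f s))
      (fun s => ((1 / (k : ℝ) - 1) / s + deriv f s / f s) / 2)
      (fun s => 1 / (k * s)) s := by
  have hk' : (k : ℝ) ≠ 0 := Nat.cast_ne_zero.2 hk
  have hs' := hs.ne'
  have hpow : ∀ p : ℝ, ContDiffAt ℝ ∞ (fun s : ℝ => s ^ p) s := fun p =>
    Real.contDiffAt_rpow_const_of_ne hs'
  have hdpow : ∀ p : ℝ, HasDerivAt (fun s : ℝ => s ^ p) (p * (s ^ p / s)) s := fun p => by
    rw [← Real.rpow_sub_one hs']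
    exact Real.hasDerivAt_rpow_const (Or.inl hs')
  have hdf : HasDerivAt f (deriv f s) s := (hfs.differentiableAt (by simp)).hasDerivAt
  have hp : ∀ p : ℝ, s ^ p ≠ 0 := fun p => (Real.rpow_pos_of_pos hs p).ne'
  -- Exhibits the factor `s^(1/k-1)` of `a` inside `c`, as the identity `a C = c γ` requires.
  have hsplit : s ^ (2 / (k : ℝ)) = s ^ (1 / (k : ℝ) - 1) * s ^ (1 / (k : ℝ)) * s := by
    rw [Real.rpow_sub_one hs', show 2 / (k : ℝ) = 1 / k + 1 / k by ring, Real.rpow_add hs]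
    field_simp
  refine ⟨?_, ?_, ?_, ?_, ?_, ?_, ?_, ?_, ?_, ?_, ?_⟩
  · exact mul_ne_zero (hp _) (one_div_ne_zero hf)
  · exact mul_ne_zero (hp _) (mul_ne_zero hε hf)
  · exact hp _
  · exact (hpow _).mul (contDiffAt_const.div hfs hf)
  · exact (hpow _).mul (contDiffAt_const.mul hfs)
  · exact hpow _
  · convert! (hdpow (1 / (k : ℝ) - 1)).mul ((hasDerivAt_const s (1 : ℝ)).fun_div hdf hf) using 1
    field_simp
    ring
  · convert! (hdpow (1 / (k : ℝ) - 1)).mul (hdf.const_mul ε) using 1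
    field_simp
  · convert! hdpow (2 / (k : ℝ)) using 1
    field_simp
  · field_simp
  · rw [hsplit]
    field_simp

/-- The powers of `s` are tuned to the fibre dimension: with `finrank E = k` the terms in `f'^2`,
and those in `f` without derivatives, cancel, leaving expressions linear in `f'` and `f''` up to the
outer factors `1/f` and `f`. -/
theorem coordRicci_schwarzschildCoordMetric [FiniteDimensional ℝ E] {k : ℕ} (hk : k ≠ 0)
    (hE : Module.finrank ℝ E = k) {ε : ℝ} (hε : ε ≠ 0) {f : ℝ → ℝ} {U : Set ℝ} (hU : IsOpen U)
    (hU0 : U ⊆ Ioi 0) (hf : ContDiffOn ℝ ∞ f U) (hf0 : ∀ s ∈ U, f s ≠ 0)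
    {h : E → E →L[ℝ] E →L[ℝ] ℝ} {z : ℝ × ℝ × E} (hz : z.1 ∈ U)
    (hh : ∀ᶠ y in 𝓝 z.2.2, ContDiffAt ℝ ∞ h y)
    (hn : ∀ᶠ y in 𝓝 z.2.2, ∀ v, (∀ w, h y v w = 0) → v = 0)
    (hs : ∀ᶠ y in 𝓝 z.2.2, ∀ v w, h y v w = h y w v) (w x : ℝ × ℝ × E) :
    coordRicci (schwarzschildCoordMetric k ε f h) z w x =
      coordRicci h z.2.2 w.2.2 x.2.2
        - (deriv (deriv f) z.1 + deriv f z.1 / (k * z.1)) / (2 * f z.1) * (w.1 * x.1)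
        - ε * f z.1 * (deriv (deriv f) z.1 + deriv f z.1 / (k * z.1)) / 2 * (w.2.1 * x.2.1)
        - 1 / k * (z.1 ^ (1 / (k : ℝ)) * deriv f z.1) * h z.2.2 w.2.2 x.2.2 := by
  have hk' : (k : ℝ) ≠ 0 := Nat.cast_ne_zero.2 hk
  have hz0 : 0 < z.1 := hU0 hz
  have hz' := hz0.ne'
  have hfz := hf0 _ hz
  have hev : ∀ᶠ s in 𝓝 z.1, s ∈ U := hU.mem_nhds hz
  have hcd : ∀ s ∈ U, ContDiffAt ℝ ∞ f s := fun s hs => hf.contDiffAt (hU.mem_nhds hs)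
  have hd1 : HasDerivAt f (deriv f z.1) z.1 :=
    ((hcd _ hz).differentiableAt (by simp)).hasDerivAt
  have hd2 : HasDerivAt (deriv f) (deriv (deriv f) z.1) z.1 :=
    (((hf.deriv_of_isOpen hU (m := ∞) (by simp)).contDiffAt (hU.mem_nhds hz)).differentiableAt
      (by simp)).hasDerivAt
  have hdpow : ∀ p : ℝ, HasDerivAt (fun s : ℝ => s ^ p) (p * (z.1 ^ p / z.1)) z.1 := fun p => by
    rw [← Real.rpow_sub_one hz']
    exact Real.hasDerivAt_rpow_const (Or.inl hz')
  have hid := hasDerivAt_id z.1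
  have hinv := (hasDerivAt_const z.1 (1 / (k : ℝ) - 1)).div hid hz'
  have hlog := hd2.div hd1 hfz
  rw [schwarzschildCoordMetric, coordRicci_warpedMetric
    (hev.mono fun s hs => isWarpedConnection_schwarzschild hk hε (hU0 hs) (hf0 s hs) (hcd s hs))
    hh hn hs ((hinv.sub hlog).div_const 2)
    (((((hd1.pow 2).const_mul (1 / (k : ℝ) - 1)).div hid hz').add (hd1.mul hd2)).const_mul (ε / 2))
    (((hdpow (1 / (k : ℝ))).mul hd1).const_mul (1 / (k : ℝ)))
    ((hinv.add hlog).div_const 2)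
    ((hasDerivAt_const z.1 (1 : ℝ)).div (hid.const_mul (k : ℝ)) (mul_ne_zero hk' hz'))
    w x, hE]
  simp only [id, Pi.pow_apply]
  congr 1
  · congr 1
    · rw [sub_eq_add_neg]
      congr 1
      rw [← neg_mul]
      congr 1
      field_simp
      ring
    · field_simp
      ring
  · field_simp
    ring

end SchwarzschildCoordinates

/-! ### The differential equation for the lapse and its solutions. -/

section ProfileEquation

open Filter Topology

theorem mem_sDomain {J : TopologicalSpace.Opens ℝ} {s : ℝ} : s ∈ sDomain J ↔ 0 < s ∧ √s ∈ J :=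
  Iff.rfl

theorem sq_mem_sDomain {J : TopologicalSpace.Opens ℝ} {r : ℝ} (hr : 0 < r) :
    r ^ 2 ∈ sDomain J ↔ r ∈ J := by
  rw [mem_sDomain, Real.sqrt_sq hr.le]
  exact and_iff_right (by positivity)

/-- The function `4 √s u²(√s)`. -/
def lapse (u : ℝ → ℝ) (s : ℝ) : ℝ := 4 * √s * u √s ^ 2

theorem lapse_sq (u : ℝ → ℝ) {r : ℝ} (hr : 0 ≤ r) : lapse u (r ^ 2) = 4 * r * u r ^ 2 := by
  rw [lapse, Real.sqrt_sq hr]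

theorem contDiffOn_lapse {J : TopologicalSpace.Opens ℝ} {u : ℝ → ℝ} (hu : ContDiffOn ℝ ∞ u J) :
    ContDiffOn ℝ ∞ (lapse u) (sDomain J) := by
  have hsqrt : ContDiffOn ℝ ∞ Real.sqrt (sDomain J) := fun s hs =>
    (Real.contDiffAt_sqrt (ne_of_gt hs.1)).contDiffWithinAt
  exact (contDiffOn_const.mul hsqrt).mul ((hu.comp hsqrt fun s hs => hs.2).pow 2)

theorem lapse_pos {J : TopologicalSpace.Opens ℝ} {u : ℝ → ℝ} (hu : ∀ r ∈ J, 0 < u r) {s : ℝ}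
    (hs : s ∈ sDomain J) : 0 < lapse u s :=
  mul_pos (mul_pos (by norm_num) (Real.sqrt_pos.2 hs.1)) (pow_pos (hu _ hs.2) 2)

/-- Solutions of `f' = k ν s^(-1/k) - k lam s^(1/k)`. -/
def profileLapse (k : ℕ) (lam ν C s : ℝ) : ℝ :=
  (k : ℝ) ^ 2 * ν / (k - 1) * s ^ (1 - 1 / (k : ℝ))
    - (k : ℝ) ^ 2 * lam / (k + 1) * s ^ (1 + 1 / (k : ℝ)) + 4 * C

theorem hasDerivAt_profileLapse {k : ℕ} (hk : 2 ≤ k) (lam ν C : ℝ) {s : ℝ} (hs : 0 < s) :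
    HasDerivAt (profileLapse k lam ν C)
      (k * ν * s ^ (-(1 / (k : ℝ))) - k * lam * s ^ (1 / (k : ℝ))) s := by
  have hk2 : (2 : ℝ) ≤ k := by exact_mod_cast hk
  have hk0 : (k : ℝ) ≠ 0 := by positivity
  have hk1 : (k : ℝ) - 1 ≠ 0 := by linarith
  have hk3 : (k : ℝ) + 1 ≠ 0 := by positivity
  convert! (((Real.hasDerivAt_rpow_const (p := 1 - 1 / (k : ℝ)) (Or.inl hs.ne')).const_mul
    ((k : ℝ) ^ 2 * ν / (k - 1))).sub ((Real.hasDerivAt_rpow_const (p := 1 + 1 / (k : ℝ))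
    (Or.inl hs.ne')).const_mul ((k : ℝ) ^ 2 * lam / (k + 1)))).add_const (4 * C) using 1
  rw [show 1 - 1 / (k : ℝ) - 1 = -(1 / (k : ℝ)) by ring,
    show 1 + 1 / (k : ℝ) - 1 = 1 / (k : ℝ) by ring]
  field_simp

/-- This fixes the normalization of `profileLapse`: its constant `4C` becomes `C / r` after division
by `4r`. -/
theorem profileLapse_sq {k : ℕ} (hk : 2 ≤ k) (lam ν C : ℝ) {r : ℝ} (hr : 0 < r) :
    profileLapse k lam ν C (r ^ 2) = 4 * r * profile k lam ν C r := by
  have hk2 : (2 : ℝ) ≤ k := by exact_mod_cast hk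
  have hk0 : (k : ℝ) ≠ 0 := by positivity
  have hk1 : (k : ℝ) - 1 ≠ 0 := by linarith
  have hk3 : (k : ℝ) + 1 ≠ 0 := by positivity
  have h1 : (r ^ 2) ^ (1 - 1 / (k : ℝ)) = r * r ^ (1 - 2 / (k : ℝ)) := by
    rw [← Real.rpow_natCast_mul hr.le, ← Real.rpow_one_add' hr.le]
    · congr 1
      push_cast
      ring
    · have : 2 / (k : ℝ) ≤ 1 := by rw [div_le_one (by positivity)]; exact hk2
      linarith
  have h2 : (r ^ 2) ^ (1 + 1 / (k : ℝ)) = r * r ^ (1 + 2 / (k : ℝ)) := by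
    rw [← Real.rpow_natCast_mul hr.le, ← Real.rpow_one_add' hr.le]
    · congr 1
      push_cast
      ring
    · positivity
  -- These factorizations match the coefficients `k² / (k ± 1)` of `profileLapse` with the inverses
  -- in `profile`.
  have e1 : 1 - (1 + 2 / (k : ℝ)) ^ 2 = -(4 * (k + 1) / k ^ 2) := by field_simp; ring
  have e2 : 1 - (1 - 2 / (k : ℝ)) ^ 2 = 4 * (k - 1) / k ^ 2 := by field_simp; ring
  rw [profileLapse, profile, h1, h2, e1, e2]
  field_simp
  ring

theorem deriv_lapse_of_profile {k : ℕ} (hk : 2 ≤ k) {J : TopologicalSpace.Opens ℝ}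
    {u : ℝ → ℝ} {lam ν C : ℝ} (hu : ∀ r ∈ J, u r ^ 2 = profile k lam ν C r) {s : ℝ}
    (hs : s ∈ sDomain J) : deriv (lapse u) s =
        k * ν * s ^ (-(1 / (k : ℝ))) - k * lam * s ^ (1 / (k : ℝ)) := by
  have heq : lapse u =ᶠ[𝓝 s] profileLapse k lam ν C := by
    filter_upwards [(sDomain J).isOpen.mem_nhds hs] with t ht
    have h0 : 0 < √t := Real.sqrt_pos.2 ht.1
    conv_rhs => rw [← Real.sq_sqrt ht.1.le]
    rw [profileLapse_sq hk lam ν C h0, lapse, hu _ ht.2]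
  rw [heq.deriv_eq, (hasDerivAt_profileLapse hk lam ν C hs.1).deriv]

theorem exists_profile_of_deriv_lapse {k : ℕ} (hk : 2 ≤ k) {J : TopologicalSpace.Opens ℝ}
    (hJ0 : (J : Set ℝ) ⊆ Ioi 0) (hJ : IsPreconnected (J : Set ℝ)) {u : ℝ → ℝ}
    (hu : ContDiffOn ℝ ∞ u J) {lam ν : ℝ}
    (h : ∀ s ∈ sDomain J, deriv (lapse u) s =
        k * ν * s ^ (-(1 / (k : ℝ))) - k * lam * s ^ (1 / (k : ℝ))) :
    ∃ C : ℝ, ∀ r ∈ J, u r ^ 2 = profile k lam ν C r := by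
  -- The difference is pulled back by `r ↦ r²` in order to be constant on `J` itself, where
  -- connectedness is assumed.
  have hder : ∀ r ∈ J, HasDerivAt (fun r => lapse u (r ^ 2) - profileLapse k lam ν 0 (r ^ 2)) 0 r :=
    fun r hr => by
      have hr0 : 0 < r := hJ0 hr
      have hs : r ^ 2 ∈ sDomain J := (sq_mem_sDomain hr0).2 hr
      have h1 : HasDerivAt (lapse u) _ (r ^ 2) :=
        ((contDiffOn_lapse hu).contDiffAt ((sDomain J).isOpen.mem_nhds hs)).differentiableAt
          (by simp) |>.hasDerivAt
      have h2 := h1.sub (hasDerivAt_profileLapse hk lam ν 0 hs.1)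
      rw [h _ hs, sub_self] at h2
      simpa [Function.comp_def] using
        HasDerivAt.comp (h := fun r : ℝ => r ^ 2) r h2 (hasDerivAt_pow 2 r)
  obtain ⟨c, hc⟩ := J.isOpen.exists_is_const_of_deriv_eq_zero hJ
    (fun r hr => (hder r hr).differentiableAt.differentiableWithinAt)
    (fun r hr => (hder r hr).deriv)
  refine ⟨c / 4, fun r hr => ?_⟩
  have hr0 : 0 < r := hJ0 hr
  have key : lapse u (r ^ 2) = profileLapse k lam ν (c / 4) (r ^ 2) := by
    have := hc r hr
    simp only [profileLapse] at this ⊢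
    linarith
  rw [lapse_sq u hr0.le, profileLapse_sq hk lam ν _ hr0] at key
  exact mul_left_cancel₀ (by positivity) key

/-- The derivative of `f' = k ν s^(-1/k) - k lam s^(1/k)` in the form of the Einstein equation in
the direction of `s`. -/
theorem deriv_deriv_of_deriv {k : ℕ} (hk : k ≠ 0) {U : Set ℝ} (hU : IsOpen U) {f : ℝ → ℝ}
    {lam ν s : ℝ} (hs : s ∈ U) (hs0 : 0 < s)
    (h : ∀ s ∈ U, deriv f s = k * ν * s ^ (-(1 / (k : ℝ))) - k * lam * s ^ (1 / (k : ℝ))) :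
    deriv (deriv f) s + deriv f s / (k * s) = -2 * lam * s ^ (1 / (k : ℝ) - 1) := by
  have hk0 : (k : ℝ) ≠ 0 := Nat.cast_ne_zero.2 hk
  have hd : ∀ p : ℝ, HasDerivAt (fun s : ℝ => s ^ p) (p * s ^ (p - 1)) s := fun p =>
    Real.hasDerivAt_rpow_const (Or.inl hs0.ne')
  have heq : deriv f =ᶠ[𝓝 s] fun s =>
      k * ν * s ^ (-(1 / (k : ℝ))) - k * lam * s ^ (1 / (k : ℝ)) := by
    filter_upwards [hU.mem_nhds hs] with t ht using h t ht
  -- In `f'' + f'/(ks)` the `ν` terms cancel and the two `λ` terms, both `-lam * s^(1/k-1)`, add up.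
  rw [heq.deriv_eq, (((hd _).const_mul (k * ν)).fun_sub ((hd _).const_mul (k * lam))).deriv, h s hs]
  rw [Real.rpow_sub_one hs0.ne', Real.rpow_sub_one hs0.ne']
  field_simp
  ring

end ProfileEquation

/-! ### Charts of open subsets of the line. -/

section OpensReal

open Filter Topology

variable (U : TopologicalSpace.Opens ℝ)

theorem extChartAt_opens_target (p : U) : (extChartAt 𝓘(ℝ, ℝ) p).target = U := by
  ext z
  constructor
  · intro hz
    rw [← (extChartAt 𝓘(ℝ, ℝ) p).right_inv hz]
    exact ((extChartAt 𝓘(ℝ, ℝ) p).symm z).2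
  · intro hz
    have : (⟨z, hz⟩ : U) ∈ (extChartAt 𝓘(ℝ, ℝ) p).source := by
      simp only [extChartAt_source, TopologicalSpace.Opens.chartAt_eq,
        OpenPartialHomeomorph.subtypeRestr_source, mem_preimage, chartAt_self_eq]
      exact mem_univ _
    exact (extChartAt 𝓘(ℝ, ℝ) p).map_source this

theorem extChartAt_opens_symm_apply (p : U) {z : ℝ} (hz : z ∈ U) :
    ((extChartAt 𝓘(ℝ, ℝ) p).symm z : ℝ) = z :=
  (extChartAt 𝓘(ℝ, ℝ) p).right_inv (by rwa [extChartAt_opens_target])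

theorem mfderiv_opens_val (q : U) (v : TangentSpace 𝓘(ℝ, ℝ) q) :
    mfderiv 𝓘(ℝ, ℝ) 𝓘(ℝ, ℝ) (Subtype.val : U → ℝ) q v = v := by
  -- The preferred chart at `q` is, by definitional unfolding, the inclusion, and a preferred chart
  -- has identity derivative at its own base point.
  have h : mfderiv 𝓘(ℝ, ℝ) 𝓘(ℝ, ℝ) (extChartAt 𝓘(ℝ, ℝ) q) q = _ := mfderiv_extChartAt_self
  exact congrArg (fun L => L v) h

end OpensReal

/-! ### Metrics in the preferred charts of a manifold without boundary. -/

section BoundarylessChart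

variable {E : Type*} [NormedAddCommGroup E] [NormedSpace ℝ E] {H : Type*} [TopologicalSpace H]
  {I : ModelWithCorners ℝ E H} {M : Type*} [TopologicalSpace M]
  [ChartedSpace H M]

theorem coordForm_apply (g : M → E →L[ℝ] E →L[ℝ] ℝ) (p : M) (z v w : E) :
    coordForm I g p z v w = g ((extChartAt I p).symm z)
      (mfderiv 𝓘(ℝ, E) I (extChartAt I p).symm z v)
      (mfderiv 𝓘(ℝ, E) I (extChartAt I p).symm z w) := rfl

theorem coordForm_symm {g : M → E →L[ℝ] E →L[ℝ] ℝ} (hg : ∀ p v w, g p v w = g p w v)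
    (p : M) (z v w : E) : coordForm I g p z v w = coordForm I g p z w v := by
  rw [coordForm_apply, coordForm_apply]
  exact hg _ _ _

variable [I.Boundaryless]

theorem IsPseudoRiemannian.contDiffAt_coordForm {g : BilinField I M}
    (hg : IsPseudoRiemannian I g) {p : M} {z : E} (hz : z ∈ (extChartAt I p).target) :
    ContDiffAt ℝ ∞ (coordForm I g p) z :=
  (hg.smooth p).contDiffAt ((isOpen_extChartAt_target p).mem_nhds hz)

variable [IsManifold I ∞ M]

theorem isInvertible_mfderiv_extChartAt_symm {p : M} {z : E} (hz : z ∈ (extChartAt I p).target) :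
    (mfderiv 𝓘(ℝ, E) I (extChartAt I p).symm z).IsInvertible := by
  have : IsManifold I 1 M := .of_le (n := ∞) (by simp)
  have h := isInvertible_mfderivWithin_extChartAt_symm hz
  rwa [I.range_eq_univ, mfderivWithin_univ] at h

theorem mdifferentiableAt_extChartAt_symm {p : M} {z : E} (hz : z ∈ (extChartAt I p).target) :
    MDifferentiableAt 𝓘(ℝ, E) I (extChartAt I p).symm z := by
  have : IsManifold I 1 M := .of_le (n := ∞) (by simp)
  have h := mdifferentiableWithinAt_extChartAt_symm hz
  rwa [I.range_eq_univ, mdifferentiableWithinAt_univ] at h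

theorem mfderiv_extChartAt_symm_self (p : M) (v : E) :
    mfderiv 𝓘(ℝ, E) I (extChartAt I p).symm (extChartAt I p p) v = v := by
  have : IsManifold I 1 M := .of_le (n := ∞) (by simp)
  have h := mfderivWithin_range_extChartAt_symm (I := I) (x := p)
  rw [I.range_eq_univ, mfderivWithin_univ] at h
  exact congrArg (fun L => L v) h

/-- The identification of the tangent space at `p` with `E` is the one made by the preferred chart
at `p`, so at the base point nothing is transformed. -/
theorem coordForm_apply_self (g : M → E →L[ℝ] E →L[ℝ] ℝ) (p : M) (v w : E) :
    coordForm I g p (extChartAt I p p) v w = g p v w := by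
  rw [coordForm_apply, extChartAt_to_inv]
  congr 1
  · exact congrArg _ (mfderiv_extChartAt_symm_self p v)
  · exact mfderiv_extChartAt_symm_self p w

theorem exists_equiv_mfderiv_extChartAt_symm {p : M} {z : E}
    (hz : z ∈ (extChartAt I p).target) :
    ∃ e : E ≃L[ℝ] E, ∀ w : E, mfderiv 𝓘(ℝ, E) I (extChartAt I p).symm z w = e w := by
  obtain ⟨e, he⟩ := isInvertible_mfderiv_extChartAt_symm hz
  exact ⟨e, fun w => by rw [← he]; rfl⟩

theorem coordForm_nondegenerate {g : M → E →L[ℝ] E →L[ℝ] ℝ}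
    (hg : ∀ p v, (∀ w, g p v w = 0) → v = 0) {p : M} {z : E}
    (hz : z ∈ (extChartAt I p).target) (v : E) (hv : ∀ w : E, coordForm I g p z v w = 0) :
    v = 0 := by
  obtain ⟨e, he⟩ := exists_equiv_mfderiv_extChartAt_symm hz
  simp only [coordForm_apply, he] at hv
  have h0 : e v = 0 := hg _ _ fun w => by
    have := hv (e.symm w)
    rwa [e.apply_symm_apply] at this
  exact e.map_eq_zero_iff.1 h0

end BoundarylessChart

/-! ### Warped metrics on a product of an open set, a line and a fibre. -/

section ProductChart

open Filter Topology

variable {k : ℕ} {F : Type*} [TopologicalSpace F] [ChartedSpace (EuclideanSpace ℝ (Fin k)) F]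
  {U : TopologicalSpace.Opens ℝ}

theorem mem_extChartAt_prodModel_target {p : U × ℝ × F} {z : ℝ × ℝ × EuclideanSpace ℝ (Fin k)} :
    z ∈ (extChartAt (prodModel k) p).target ↔
      z.1 ∈ U ∧ z.2.2 ∈ (extChartAt (𝓡 k) p.2.2).target := by
  have h : (extChartAt 𝓘(ℝ, ℝ) p.2.1).target = univ := by
    rw [extChartAt_model_space_eq_id]
    rfl
  rw [extChartAt_prod, extChartAt_prod, PartialEquiv.prod_target, PartialEquiv.prod_target,
    mem_prod, mem_prod, extChartAt_opens_target, h]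
  exact and_congr Iff.rfl (and_iff_right (mem_univ z.2.1))

theorem extChartAt_prodModel_apply (p q : U × ℝ × F) :
    extChartAt (prodModel k) p q = ((q.1 : ℝ), q.2.1, extChartAt (𝓡 k) p.2.2 q.2.2) := by
  rw [extChartAt_prod, extChartAt_prod]
  rfl

theorem extChartAt_prodModel_symm (p : U × ℝ × F) :
    ((extChartAt (prodModel k) p).symm : ℝ × ℝ × EuclideanSpace ℝ (Fin k) → U × ℝ × F) =
      fun z => ((extChartAt 𝓘(ℝ, ℝ) p.1).symm z.1, z.2.1,
        (extChartAt (𝓡 k) p.2.2).symm z.2.2) := by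
  rw [extChartAt_prod, extChartAt_prod]
  rfl

/-- Differentiate chart ∘ inverse chart = identity; the chart is the inclusion, with identity
derivative. -/
theorem mfderiv_extChartAt_opens_symm (p : U) {z : ℝ} (hz : z ∈ U) (v : ℝ) :
    mfderiv 𝓘(ℝ, ℝ) 𝓘(ℝ, ℝ) (extChartAt 𝓘(ℝ, ℝ) p).symm z v = v := by
  have hz' : z ∈ (extChartAt 𝓘(ℝ, ℝ) p).target := by rwa [extChartAt_opens_target]
  have h := mfderiv_extChartAt_comp_mfderivWithin_extChartAt_symm hz'
  have h' := congrArg (fun L => L v) h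
  simp only [ModelWithCorners.range_eq_univ, mfderivWithin_univ] at h'
  exact (mfderiv_opens_val U _ _).symm.trans h'

variable [IsManifold (𝓡 k) ∞ F]

theorem mfderiv_extChartAt_prodModel_symm {p : U × ℝ × F}
    {z : ℝ × ℝ × EuclideanSpace ℝ (Fin k)} (hz : z ∈ (extChartAt (prodModel k) p).target)
    (v : ℝ × ℝ × EuclideanSpace ℝ (Fin k)) :
    mfderiv 𝓘(ℝ, ℝ × ℝ × EuclideanSpace ℝ (Fin k)) (prodModel k)
        (extChartAt (prodModel k) p).symm z v =
      (v.1, v.2.1, mfderiv 𝓘(ℝ, EuclideanSpace ℝ (Fin k)) (𝓡 k)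
        (extChartAt (𝓡 k) p.2.2).symm z.2.2 v.2.2) := by
  rw [mem_extChartAt_prodModel_target] at hz
  have h1 : HasMFDerivAt 𝓘(ℝ, ℝ × ℝ × EuclideanSpace ℝ (Fin k)) 𝓘(ℝ, ℝ) Prod.fst z
    (ContinuousLinearMap.fst ℝ ℝ (ℝ × EuclideanSpace ℝ (Fin k))) :=
    hasFDerivAt_fst.hasMFDerivAt
  have h2 : HasMFDerivAt 𝓘(ℝ, ℝ × ℝ × EuclideanSpace ℝ (Fin k)) 𝓘(ℝ, ℝ)
      (fun z : ℝ × ℝ × EuclideanSpace ℝ (Fin k) => z.2.1) z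
      ((ContinuousLinearMap.fst ℝ ℝ (EuclideanSpace ℝ (Fin k))).comp (.snd ℝ ℝ _)) :=
    (hasFDerivAt_fst.comp z hasFDerivAt_snd).hasMFDerivAt
  have h3 : HasMFDerivAt 𝓘(ℝ, ℝ × ℝ × EuclideanSpace ℝ (Fin k)) 𝓘(ℝ, EuclideanSpace ℝ (Fin k))
      (fun z : ℝ × ℝ × EuclideanSpace ℝ (Fin k) => z.2.2) z
      ((ContinuousLinearMap.snd ℝ ℝ (EuclideanSpace ℝ (Fin k))).comp (.snd ℝ ℝ _)) :=
    (hasFDerivAt_snd.comp z hasFDerivAt_snd).hasMFDerivAt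
  have hU : MDifferentiableAt 𝓘(ℝ, ℝ) 𝓘(ℝ, ℝ) (extChartAt 𝓘(ℝ, ℝ) p.1).symm z.1 :=
    mdifferentiableAt_extChartAt_symm (by rw [extChartAt_opens_target]; exact hz.1)
  have hF := mdifferentiableAt_extChartAt_symm (I := 𝓡 k) hz.2
  have key := (hU.hasMFDerivAt.comp z h1).prodMk (h2.prodMk (hF.hasMFDerivAt.comp z h3))
  rw [extChartAt_prodModel_symm]
  refine (congrArg (fun L => L v) key.mfderiv).trans ?_
  exact Prod.ext (mfderiv_extChartAt_opens_symm p.1 hz.1 v.1) rfl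

/-- The bridge from manifold to coordinates: the chart leaves `s` and `y` unchanged and acts on the
fibre alone. -/
theorem coordForm_warpedForm (a b c : ℝ → ℝ)
    (gF : F → EuclideanSpace ℝ (Fin k) →L[ℝ] EuclideanSpace ℝ (Fin k) →L[ℝ] ℝ) {p : U × ℝ × F}
    {z : ℝ × ℝ × EuclideanSpace ℝ (Fin k)} (hz : z ∈ (extChartAt (prodModel k) p).target) :
    coordForm (prodModel k)
        (fun q : U × ℝ × F => warpedForm (a q.1) (b q.1) (c q.1) (gF q.2.2)) p z =
      warpedMetric a b c (coordForm (𝓡 k) gF p.2.2) z := by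
  refine ContinuousLinearMap.ext fun v => ContinuousLinearMap.ext fun w => ?_
  rw [coordForm_apply, mfderiv_extChartAt_prodModel_symm hz, mfderiv_extChartAt_prodModel_symm hz,
    extChartAt_prodModel_symm]
  refine (warpedForm_apply _ _ _ _ _ _).trans (Eq.trans ?_ (warpedForm_apply _ _ _ _ v w).symm)
  dsimp only
  rw [extChartAt_opens_symm_apply U p.1 (mem_extChartAt_prodModel_target.1 hz).1, coordForm_apply]

theorem isPseudoRiemannian_warpedForm {a b c : ℝ → ℝ} (ha : ContDiffOn ℝ ∞ a U)
    (hb : ContDiffOn ℝ ∞ b U) (hc : ContDiffOn ℝ ∞ c U) (ha0 : ∀ s ∈ U, a s ≠ 0)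
    (hb0 : ∀ s ∈ U, b s ≠ 0) (hc0 : ∀ s ∈ U, c s ≠ 0)
    {gF : F → EuclideanSpace ℝ (Fin k) →L[ℝ] EuclideanSpace ℝ (Fin k) →L[ℝ] ℝ}
    (hg : IsPseudoRiemannian (𝓡 k) gF) :
    IsPseudoRiemannian (prodModel k)
      (fun q : U × ℝ × F => warpedForm (a q.1) (b q.1) (c q.1) (gF q.2.2)) where
  symm p v w := by
    have h : ∀ v w : EuclideanSpace ℝ (Fin k), gF p.2.2 v w = gF p.2.2 w v := hg.symm p.2.2
    exact (warpedForm_apply _ _ _ _ v w).trans (((by rw [h, mul_comm v.1, mul_comm v.2.1] :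
      _ = _)).trans (warpedForm_apply _ _ _ _ w v).symm)
  nondegenerate p := warpedForm_nondegenerate (ha0 _ p.1.2) (hb0 _ p.1.2) (hc0 _ p.1.2)
    (hg.nondegenerate p.2.2)
  smooth p := by
    refine ContDiffOn.congr (fun z hz => ?_) fun z hz => coordForm_warpedForm a b c gF hz
    obtain ⟨h1, h2⟩ := mem_extChartAt_prodModel_target.1 hz
    have hU := U.isOpen.mem_nhds h1
    exact (contDiffAt_warpedMetric (ha.contDiffAt hU) (hb.contDiffAt hU) (hc.contDiffAt hU)
      (hg.contDiffAt_coordForm h2)).contDiffWithinAt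

theorem ricci_warpedForm (a b c : ℝ → ℝ)
    (gF : F → EuclideanSpace ℝ (Fin k) →L[ℝ] EuclideanSpace ℝ (Fin k) →L[ℝ] ℝ) (p : U × ℝ × F)
    (v w : ℝ × ℝ × EuclideanSpace ℝ (Fin k)) :
    ricci (prodModel k) (fun q : U × ℝ × F => warpedForm (a q.1) (b q.1) (c q.1) (gF q.2.2))
        p v w =
      coordRicci (warpedMetric a b c (coordForm (𝓡 k) gF p.2.2))
        ((p.1 : ℝ), p.2.1, extChartAt (𝓡 k) p.2.2 p.2.2) v w := by
  have h : coordForm (prodModel k)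
      (fun q : U × ℝ × F => warpedForm (a q.1) (b q.1) (c q.1) (gF q.2.2)) p
      =ᶠ[𝓝 (extChartAt (prodModel k) p p)] warpedMetric a b c (coordForm (𝓡 k) gF p.2.2) := by
    filter_upwards [extChartAt_target_mem_nhds p] with z hz using coordForm_warpedForm a b c gF hz
  rw [← extChartAt_prodModel_apply]
  exact congrFun (congrFun (coordRicci_congr h) v) w

end ProductChart

/-! ### The Einstein equation as an equation for the lapse. -/

section EinsteinCondition

open Filter Topology

theorem exists_apply_ne_zero_of_nondegenerate {E : Type*} [NormedAddCommGroup E] [NormedSpace ℝ E]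
    [Nontrivial E] {B : E →L[ℝ] E →L[ℝ] ℝ} (hB : ∀ v, (∀ w, B v w = 0) → v = 0) :
    ∃ v w, B v w ≠ 0 := by
  obtain ⟨v, hv⟩ := exists_ne (0 : E)
  by_contra! h
  exact hv (hB v (h v))

variable {k : ℕ} {F : Type*} [TopologicalSpace F] [ChartedSpace (EuclideanSpace ℝ (Fin k)) F]
  {J : TopologicalSpace.Opens ℝ} {ε : ℝ} {u : ℝ → ℝ}
  {gF : F → EuclideanSpace ℝ (Fin k) →L[ℝ] EuclideanSpace ℝ (Fin k) →L[ℝ] ℝ}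

theorem generalizedSchwarzschild_eq_warpedForm :
    generalizedSchwarzschild J ε u gF = fun q : sDomain J × ℝ × F =>
      warpedForm ((fun s : ℝ => s ^ (1 / (k : ℝ) - 1) * (1 / lapse u s)) q.1)
        ((fun s : ℝ => s ^ (1 / (k : ℝ) - 1) * (ε * lapse u s)) q.1)
        ((fun s : ℝ => s ^ (2 / (k : ℝ))) q.1) (gF q.2.2) := rfl

variable [IsManifold (𝓡 k) ∞ F]

theorem isPseudoRiemannian_generalizedSchwarzschild (hg : IsPseudoRiemannian (𝓡 k) gF)
    (hu : ContDiffOn ℝ ∞ u J) (hu0 : ∀ r ∈ J, 0 < u r) (hε : ε ≠ 0) :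
    IsPseudoRiemannian (prodModel k) (generalizedSchwarzschild J ε u gF) := by
  have hpow : ∀ p : ℝ, ContDiffOn ℝ ∞ (fun s : ℝ => s ^ p) (sDomain J) := fun p s hs =>
    (Real.contDiffAt_rpow_const_of_ne (ne_of_gt hs.1)).contDiffWithinAt
  have hpow0 : ∀ p : ℝ, ∀ s ∈ sDomain J, s ^ p ≠ 0 := fun p s hs =>
    (Real.rpow_pos_of_pos hs.1 p).ne'
  have hf := contDiffOn_lapse hu
  have hf0 : ∀ s ∈ sDomain J, lapse u s ≠ 0 := fun s hs => (lapse_pos hu0 hs).ne'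
  rw [generalizedSchwarzschild_eq_warpedForm]
  exact isPseudoRiemannian_warpedForm ((hpow _).mul (contDiffOn_const.div hf hf0))
    ((hpow _).mul (contDiffOn_const.mul hf)) (hpow _)
    (fun s hs => mul_ne_zero (hpow0 _ s hs) (one_div_ne_zero (hf0 s hs)))
    (fun s hs => mul_ne_zero (hpow0 _ s hs) (mul_ne_zero hε (hf0 s hs))) (hpow0 _) hg

theorem ricci_generalizedSchwarzschild (hk : k ≠ 0) {ν : ℝ} (hg : IsEinstein (𝓡 k) gF ν)
    (hu : ContDiffOn ℝ ∞ u J) (hu0 : ∀ r ∈ J, 0 < u r) (hε : ε ≠ 0) (p : sDomain J × ℝ × F)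
    (v w : ℝ × ℝ × EuclideanSpace ℝ (Fin k)) :
    ricci (prodModel k) (generalizedSchwarzschild J ε u gF) p v w =
      ν * gF p.2.2 v.2.2 w.2.2
        - (deriv (deriv (lapse u)) p.1 + deriv (lapse u) p.1 / (k * p.1)) / (2 * lapse u p.1)
          * (v.1 * w.1)
        - ε * lapse u p.1 * (deriv (deriv (lapse u)) p.1 + deriv (lapse u) p.1 / (k * p.1)) / 2
          * (v.2.1 * w.2.1)
        - 1 / k * ((p.1 : ℝ) ^ (1 / (k : ℝ)) * deriv (lapse u) p.1) * gF p.2.2 v.2.2 w.2.2 := by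
  have hnhds := extChartAt_target_mem_nhds (I := 𝓡 k) p.2.2
  have hR : coordRicci (coordForm (𝓡 k) gF p.2.2) (extChartAt (𝓡 k) p.2.2 p.2.2) v.2.2 w.2.2 =
      ν * gF p.2.2 v.2.2 w.2.2 := hg.2 p.2.2 v.2.2 w.2.2
  refine (ricci_warpedForm (fun s : ℝ => s ^ (1 / (k : ℝ) - 1) * (1 / lapse u s))
    (fun s : ℝ => s ^ (1 / (k : ℝ) - 1) * (ε * lapse u s)) (fun s : ℝ => s ^ (2 / (k : ℝ))) gF
    p v w).trans ?_
  refine (coordRicci_schwarzschildCoordMetric hk (by simp) hε (sDomain J).isOpen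
    (fun s hs => hs.1) (contDiffOn_lapse hu) (fun s hs => (lapse_pos hu0 hs).ne')
    (h := coordForm (𝓡 k) gF p.2.2)
    (z := ((p.1 : ℝ), p.2.1, extChartAt (𝓡 k) p.2.2 p.2.2)) p.1.2
    ?_ ?_ ?_ v w).trans ?_
  · filter_upwards [hnhds] with y hy using hg.1.contDiffAt_coordForm hy
  · filter_upwards [hnhds] with y hy using coordForm_nondegenerate hg.1.nondegenerate hy
  · exact .of_forall fun y => coordForm_symm hg.1.symm p.2.2 y
  · rw [coordForm_apply_self, hR]

theorem isEinstein_generalizedSchwarzschild_of_profile (hk : 2 ≤ k) {ν : ℝ}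
    (hg : IsEinstein (𝓡 k) gF ν) (hu : ContDiffOn ℝ ∞ u J) (hu0 : ∀ r ∈ J, 0 < u r) (hε : ε ≠ 0)
    {lam C : ℝ} (h : ∀ r ∈ J, u r ^ 2 = profile k lam ν C r) :
    IsEinstein (prodModel k) (generalizedSchwarzschild J ε u gF) lam := by
  have hk0 : k ≠ 0 := by omega
  have hk' : (k : ℝ) ≠ 0 := Nat.cast_ne_zero.2 hk0
  refine ⟨isPseudoRiemannian_generalizedSchwarzschild hg.1 hu hu0 hε, fun p v w => ?_⟩
  have hp : 0 < (p.1 : ℝ) := p.1.2.1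
  have hf := (lapse_pos hu0 p.1.2).ne'
  have hd := fun s (hs : s ∈ sDomain J) => deriv_lapse_of_profile hk h hs
  refine (ricci_generalizedSchwarzschild hk0 hg hu hu0 hε p v w).trans
    (Eq.trans ?_ (congrArg (lam * ·) (warpedForm_apply _ _ _ _ v w)).symm)
  -- The second-order expression settles the `ds²` and `dy²` parts, the first derivative the fibre
  -- part.
  rw [deriv_deriv_of_deriv hk0 (sDomain J).isOpen p.1.2 hp hd, hd _ p.1.2]
  have h1 : (p.1 : ℝ) ^ (2 / (k : ℝ)) = (p.1 : ℝ) ^ (1 / (k : ℝ)) * (p.1 : ℝ) ^ (1 / (k : ℝ)) := by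
    rw [← Real.rpow_add hp]
    congr 1
    ring
  have hne : (p.1 : ℝ) ^ (1 / (k : ℝ)) ≠ 0 := (Real.rpow_pos_of_pos hp _).ne'
  change _ = lam * ((p.1 : ℝ) ^ (1 / (k : ℝ) - 1) * (1 / lapse u p.1) * (v.1 * w.1)
    + (p.1 : ℝ) ^ (1 / (k : ℝ) - 1) * (ε * lapse u p.1) * (v.2.1 * w.2.1)
    + (p.1 : ℝ) ^ (2 / (k : ℝ)) * gF p.2.2 v.2.2 w.2.2)
  rw [h1, Real.rpow_neg hp.le]
  field_simp
  ring

/-- Fibre directions suffice: evaluating at one pair with `g_F(v, w) ≠ 0` turns the tensor equation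
into the scalar first-order one. -/
theorem deriv_lapse_of_isEinstein [Nonempty F] (hk : 2 ≤ k) {ν : ℝ}
    (hg : IsEinstein (𝓡 k) gF ν) (hu : ContDiffOn ℝ ∞ u J) (hu0 : ∀ r ∈ J, 0 < u r) (hε : ε ≠ 0)
    {lam : ℝ} (h : IsEinstein (prodModel k) (generalizedSchwarzschild J ε u gF) lam)
    {s : ℝ} (hs : s ∈ sDomain J) :
    deriv (lapse u) s = k * ν * s ^ (-(1 / (k : ℝ))) - k * lam * s ^ (1 / (k : ℝ)) := by
  have hk0 : k ≠ 0 := by omega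
  have hk' : (k : ℝ) ≠ 0 := Nat.cast_ne_zero.2 hk0
  obtain ⟨x⟩ := ‹Nonempty F›
  -- Makes the model space nontrivial, so that such a pair exists.
  have : NeZero k := ⟨hk0⟩
  obtain ⟨v, w, hvw⟩ := exists_apply_ne_zero_of_nondegenerate (B := gF x) (hg.1.nondegenerate x)
  have key := (ricci_generalizedSchwarzschild hk0 hg hu hu0 hε (⟨s, hs⟩, 0, x)
    (0, 0, v) (0, 0, w)).symm.trans ((h.2 (⟨s, hs⟩, 0, x) (0, 0, v) (0, 0, w)).trans
      (congrArg (lam * ·) (warpedForm_apply _ _ _ _ (0, 0, v) (0, 0, w))))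
  have h1 : s ^ (2 / (k : ℝ)) = s ^ (1 / (k : ℝ)) * s ^ (1 / (k : ℝ)) := by
    rw [← Real.rpow_add hs.1]
    congr 1
    ring
  have hne : s ^ (1 / (k : ℝ)) ≠ 0 := (Real.rpow_pos_of_pos hs.1 _).ne'
  simp only [mul_zero, sub_zero, zero_add, h1] at key
  have key' : ν - 1 / k * (s ^ (1 / (k : ℝ)) * deriv (lapse u) s) =
      lam * (s ^ (1 / (k : ℝ)) * s ^ (1 / (k : ℝ))) := by
    apply mul_right_cancel₀ hvw
    linarith
  rw [Real.rpow_neg hs.1.le]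
  field_simp at key' ⊢
  linarith

theorem isEinstein_generalizedSchwarzschild_iff [Nonempty F] (hk : 2 ≤ k) {ν : ℝ}
    (hg : IsEinstein (𝓡 k) gF ν) (hJ0 : (J : Set ℝ) ⊆ Ioi 0) (hJ : IsPreconnected (J : Set ℝ))
    (hu : ContDiffOn ℝ ∞ u J) (hu0 : ∀ r ∈ J, 0 < u r) (hε : ε ≠ 0) (lam : ℝ) :
    IsEinstein (prodModel k) (generalizedSchwarzschild J ε u gF) lam ↔
      ∃ C : ℝ, ∀ r ∈ J, u r ^ 2 = profile k lam ν C r :=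
  ⟨fun h => exists_profile_of_deriv_lapse hk hJ0 hJ hu fun _ hs =>
      deriv_lapse_of_isEinstein hk hg hu hu0 hε h hs,
    fun ⟨_, h⟩ => isEinstein_generalizedSchwarzschild_of_profile hk hg hu hu0 hε h⟩

end EinsteinCondition

/-! ### The change of coordinates to the areal radius. -/

section ArealCoordinates

open Filter Topology

variable {k : ℕ} {F : Type*} [TopologicalSpace F] [ChartedSpace (EuclideanSpace ℝ (Fin k)) F]
  {J : TopologicalSpace.Opens ℝ}

/-- The bijection `r ↦ r²` of `J` onto `J²`. -/
def squareEquiv (hJ0 : (J : Set ℝ) ⊆ Ioi 0) : J ≃ sDomain J where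
  toFun r := ⟨(r : ℝ) ^ 2, (sq_mem_sDomain (hJ0 r.2)).2 r.2⟩
  invFun s := ⟨√s, s.2.2⟩
  left_inv r := Subtype.ext (Real.sqrt_sq (le_of_lt (hJ0 r.2)))
  right_inv s := Subtype.ext (Real.sq_sqrt s.2.1.le)

theorem contMDiff_squareEquiv (hJ0 : (J : Set ℝ) ⊆ Ioi 0) :
    ContMDiff 𝓘(ℝ, ℝ) 𝓘(ℝ, ℝ) ∞ (squareEquiv hJ0) := by
  rw [← ContMDiff.subtypeVal_comp_iff]
  exact ((contDiff_id.pow 2).contMDiff (f := fun r : ℝ => r ^ 2)).comp contMDiff_subtype_val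

theorem contMDiff_squareEquiv_symm (hJ0 : (J : Set ℝ) ⊆ Ioi 0) :
    ContMDiff 𝓘(ℝ, ℝ) 𝓘(ℝ, ℝ) ∞ (squareEquiv hJ0).symm := by
  rw [← ContMDiff.subtypeVal_comp_iff]
  intro s
  exact ((Real.contDiffAt_sqrt (ne_of_gt s.2.1)).contMDiffAt (f := Real.sqrt)).comp s
    contMDiff_subtype_val.contMDiffAt

/-- Both inclusions into `ℝ` have identity derivative, so the chain rule for inclusion ∘
`squareEquiv` = square ∘ inclusion gives the value. -/
theorem mfderiv_squareEquiv (hJ0 : (J : Set ℝ) ⊆ Ioi 0) (r : J) (v : ℝ) :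
    mfderiv 𝓘(ℝ, ℝ) 𝓘(ℝ, ℝ) (squareEquiv hJ0) r v = 2 * (r : ℝ) * v := by
  have h1 : MDifferentiableAt 𝓘(ℝ, ℝ) 𝓘(ℝ, ℝ) (squareEquiv hJ0) r :=
    (contMDiff_squareEquiv hJ0).mdifferentiableAt (by simp)
  have h2 : MDifferentiableAt 𝓘(ℝ, ℝ) 𝓘(ℝ, ℝ) (Subtype.val : sDomain J → ℝ) (squareEquiv hJ0 r) :=
    contMDiff_subtype_val.mdifferentiableAt (n := ∞) (by simp)
  have h3 : MDifferentiableAt 𝓘(ℝ, ℝ) 𝓘(ℝ, ℝ) (Subtype.val : J → ℝ) r :=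
    contMDiff_subtype_val.mdifferentiableAt (n := ∞) (by simp)
  have h4 : HasMFDerivAt 𝓘(ℝ, ℝ) 𝓘(ℝ, ℝ) (fun x : ℝ => x ^ 2) (r : ℝ)
      (ContinuousLinearMap.toSpanSingleton ℝ (2 * (r : ℝ))) := by
    have : HasFDerivAt (fun x : ℝ => x ^ 2)
        (ContinuousLinearMap.toSpanSingleton ℝ (2 * (r : ℝ))) (r : ℝ) := by
      simpa using (hasDerivAt_pow 2 (r : ℝ)).hasFDerivAt
    exact this.hasMFDerivAt
  have e1 := congrArg (fun L => L v) (mfderiv_comp r h2 h1)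
  have e2 := congrArg (fun L => L v) (h4.comp r h3.hasMFDerivAt).mfderiv
  have e3 := e1.symm.trans e2
  have e4 := (mfderiv_opens_val _ _ _).symm.trans e3
  refine e4.trans ((congrArg (ContinuousLinearMap.toSpanSingleton ℝ (2 * (r : ℝ)))
    (mfderiv_opens_val J r v)).trans ?_)
  rw [ContinuousLinearMap.toSpanSingleton_apply, smul_eq_mul, mul_comm]

/-- The diffeomorphism `(r, t, x) ↦ (r², t/2, x)`. -/
def arealDiffeomorph (k : ℕ) (F : Type*) [TopologicalSpace F]
    [ChartedSpace (EuclideanSpace ℝ (Fin k)) F] (hJ0 : (J : Set ℝ) ⊆ Ioi 0) :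
    (J × ℝ × F) ≃ₘ^∞⟮prodModel k, prodModel k⟯ (sDomain J × ℝ × F) where
  toFun p := (squareEquiv hJ0 p.1, p.2.1 / 2, p.2.2)
  invFun q := ((squareEquiv hJ0).symm q.1, 2 * q.2.1, q.2.2)
  left_inv p := by simp [mul_div_cancel₀]
  right_inv q := by simp
  contMDiff_toFun := ((contMDiff_squareEquiv hJ0).comp contMDiff_fst).prodMk
    (((contDiff_id.div_const 2).contMDiff.comp (contMDiff_fst.comp contMDiff_snd)).prodMk
      (contMDiff_snd.comp contMDiff_snd))
  contMDiff_invFun := ((contMDiff_squareEquiv_symm hJ0).comp contMDiff_fst).prodMk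
    (((contDiff_const.mul contDiff_id).contMDiff.comp (contMDiff_fst.comp contMDiff_snd)).prodMk
      (contMDiff_snd.comp contMDiff_snd))

theorem mfderiv_arealDiffeomorph (hJ0 : (J : Set ℝ) ⊆ Ioi 0) (p : J × ℝ × F)
    (v : ℝ × ℝ × EuclideanSpace ℝ (Fin k)) :
    mfderiv (prodModel k) (prodModel k) (arealDiffeomorph k F hJ0) p v =
      (2 * (p.1 : ℝ) * v.1, v.2.1 / 2, v.2.2) := by
  have h1 : MDifferentiableAt 𝓘(ℝ, ℝ) 𝓘(ℝ, ℝ) (squareEquiv hJ0) p.1 :=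
    (contMDiff_squareEquiv hJ0).mdifferentiableAt (by simp)
  have h2 : HasMFDerivAt 𝓘(ℝ, ℝ) 𝓘(ℝ, ℝ) (fun t : ℝ => t / 2) p.2.1
      ((2⁻¹ : ℝ) • ContinuousLinearMap.id ℝ ℝ) := by
    have : HasFDerivAt (fun t : ℝ => t / 2) ((2⁻¹ : ℝ) • ContinuousLinearMap.id ℝ ℝ) p.2.1 := by
      simpa [div_eq_inv_mul] using (hasFDerivAt_id (𝕜 := ℝ) p.2.1).const_mul (2⁻¹ : ℝ)
    exact this.hasMFDerivAt
  have hsnd := hasMFDerivAt_snd (I := 𝓘(ℝ, ℝ)) (I' := 𝓘(ℝ, ℝ).prod (𝓡 k)) p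
  have key := (h1.hasMFDerivAt.comp p
    (hasMFDerivAt_fst (I := 𝓘(ℝ, ℝ)) (I' := 𝓘(ℝ, ℝ).prod (𝓡 k)) p)).prodMk
    ((h2.comp p ((hasMFDerivAt_fst (I := 𝓘(ℝ, ℝ)) (I' := 𝓡 k) p.2).comp p hsnd)).prodMk
      ((hasMFDerivAt_snd (I := 𝓘(ℝ, ℝ)) (I' := 𝓡 k) p.2).comp p hsnd))
  refine (congrArg (fun L => L v) key.mfderiv).trans ?_
  refine Prod.ext (mfderiv_squareEquiv hJ0 p.1 v.1) (Prod.ext ?_ rfl)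
  change (2⁻¹ : ℝ) • v.2.1 = v.2.1 / 2
  rw [smul_eq_mul, div_eq_inv_mul]

end ArealCoordinates

/-! ### The pulled-back metric for two-dimensional fibres. -/

section ArealPullback

variable {F : Type*} [TopologicalSpace F] [ChartedSpace (EuclideanSpace ℝ (Fin 2)) F]
  {J : TopologicalSpace.Opens ℝ}

theorem pullbackField_arealDiffeomorph (hJ0 : (J : Set ℝ) ⊆ Ioi 0) (ε : ℝ) {u f : ℝ → ℝ}
    (hu0 : ∀ r ∈ J, 0 < u r) (hf : ∀ r ∈ J, u r ^ 2 = f r)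
    (gF : F → EuclideanSpace ℝ (Fin 2) →L[ℝ] EuclideanSpace ℝ (Fin 2) →L[ℝ] ℝ) :
    pullbackField (prodModel 2) (prodModel 2) (arealDiffeomorph 2 F hJ0)
      (generalizedSchwarzschild J ε u gF) = arealMetric J ε f gF := by
  funext p
  refine ContinuousLinearMap.ext fun v => ContinuousLinearMap.ext fun w => ?_
  have hr : 0 < (p.1 : ℝ) := hJ0 p.1.2
  have hu := hu0 p.1 p.1.2
  have e : ∀ v : ℝ × ℝ × EuclideanSpace ℝ (Fin 2),
    mfderiv (prodModel 2) (prodModel 2) (arealDiffeomorph 2 F hJ0) p v = _ :=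
    mfderiv_arealDiffeomorph hJ0 p
  change generalizedSchwarzschild J ε u gF (arealDiffeomorph 2 F hJ0 p)
    (mfderiv (prodModel 2) (prodModel 2) (arealDiffeomorph 2 F hJ0) p v)
    (mfderiv (prodModel 2) (prodModel 2) (arealDiffeomorph 2 F hJ0) p w) = _
  rw [e v, e w]
  refine (warpedForm_apply _ _ _ _ _ _).trans (Eq.trans ?_ (warpedForm_apply _ _ _ _ v w).symm)
  have hs : ((arealDiffeomorph 2 F hJ0 p).1 : ℝ) = (p.1 : ℝ) ^ 2 := rfl
  have hx : (arealDiffeomorph 2 F hJ0 p).2.2 = p.2.2 := rfl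
  rw [← hf _ p.1.2, hs, hx, Real.sqrt_sq hr.le]
  -- For `k = 2` the conformal factor is `1/r`; it cancels against `4r² / (4r)` from `ds²` and `4r /
  -- 4` from `dy²`.
  have h1 : ((p.1 : ℝ) ^ 2) ^ (1 / ((2 : ℕ) : ℝ) - 1) = (p.1 : ℝ)⁻¹ := by
    rw [← Real.rpow_natCast_mul hr.le, ← Real.rpow_neg_one]
    norm_num
  have h2 : ((p.1 : ℝ) ^ 2) ^ (2 / ((2 : ℕ) : ℝ)) = (p.1 : ℝ) ^ 2 := by
    norm_num
  rw [h1, h2]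
  field_simp
  ring

end ArealPullback

/-! ### The conformally flat metric of stereographic projection. -/

section SphericalCoordinates

open Filter Topology
open scoped RealInnerProductSpace

variable {E : Type*} [NormedAddCommGroup E] [InnerProductSpace ℝ E]

/-- The round metric of the unit sphere in stereographic coordinates. -/
def stereographicMetric (E : Type*) [NormedAddCommGroup E] [InnerProductSpace ℝ E] (z : E) :
    E →L[ℝ] E →L[ℝ] ℝ :=
  (16 * ((‖z‖ ^ 2 + 4)⁻¹) ^ 2) • innerSL ℝ

theorem stereographicMetric_apply (z v w : E) :
    stereographicMetric E z v w = 16 * ((‖z‖ ^ 2 + 4)⁻¹) ^ 2 * ⟪v, w⟫ := rfl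

theorem norm_sq_add_four_pos {E : Type*} [NormedAddCommGroup E] (z : E) :
    0 < ‖z‖ ^ 2 + 4 := by
  positivity

theorem hasFDerivAt_inv_norm_sq_add_four (z : E) :
    HasFDerivAt (fun z : E => (‖z‖ ^ 2 + 4)⁻¹)
      ((-(2 * ((‖z‖ ^ 2 + 4)⁻¹) ^ 2)) • innerSL ℝ z) z := by
  have h1 : HasFDerivAt (fun z : E => ‖z‖ ^ 2 + 4) ((2 : ℝ) • innerSL ℝ z) z := by
    simpa [two_smul] using (hasStrictFDerivAt_norm_sq z).hasFDerivAt.add_const (4 : ℝ)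
  convert! (hasDerivAt_inv (norm_sq_add_four_pos z).ne').comp_hasFDerivAt z h1 using 1
  rw [smul_smul]
  congr 1
  field_simp

theorem contDiff_inv_norm_sq_add_four : ContDiff ℝ ∞ fun z : E => (‖z‖ ^ 2 + 4)⁻¹ :=
  ((contDiff_norm_sq ℝ).add contDiff_const).inv fun z => (norm_sq_add_four_pos z).ne'

theorem contDiff_stereographicMetric : ContDiff ℝ ∞ (stereographicMetric E) :=
  (contDiff_const.mul (contDiff_inv_norm_sq_add_four.pow 2)).smul contDiff_const

theorem fderiv_stereographicMetric (z v w x : E) :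
    fderiv ℝ (stereographicMetric E) z v w x =
      -(64 * ((‖z‖ ^ 2 + 4)⁻¹) ^ 3 * ⟪z, v⟫ * ⟪w, x⟫) := by
  have h := (((hasFDerivAt_inv_norm_sq_add_four z).pow 2).const_mul (16 : ℝ)).smul_const
    (innerSL ℝ (E := E))
  refine (congrArg (fun L => L v w x) h.fderiv).trans ?_
  simp only [ContinuousLinearMap.smulRight_apply, smul_apply, innerSL_apply_apply, smul_eq_mul,
    nsmul_eq_mul]
  push_cast
  ring

theorem stereographicMetric_nondegenerate (z v : E)
    (hv : ∀ w, stereographicMetric E z v w = 0) : v = 0 := by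
  have h := hv v
  rw [stereographicMetric_apply] at h
  have := norm_sq_add_four_pos z
  simpa [this.ne'] using h

/-- The inverse of the stereographic projection has the differential of a conformal map. -/
theorem inner_fderiv_stereographic_symm {V : Type*} [NormedAddCommGroup V] [InnerProductSpace ℝ V]
    (T : E →ₗᵢ[ℝ] V) {n : V} (hn : ‖n‖ = 1) (hT : ∀ z, ⟪T z, n⟫ = 0) (z v w : E) :
    ⟪fderiv ℝ (fun z : E => (‖T z‖ ^ 2 + 4)⁻¹ • (4 : ℝ) • T z
        + (‖T z‖ ^ 2 + 4)⁻¹ • (‖T z‖ ^ 2 - 4) • n) z v,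
      fderiv ℝ (fun z : E => (‖T z‖ ^ 2 + 4)⁻¹ • (4 : ℝ) • T z
        + (‖T z‖ ^ 2 + 4)⁻¹ • (‖T z‖ ^ 2 - 4) • n) z w⟫ = stereographicMetric E z v w := by
  -- With `φ = (‖z‖² + 4)⁻¹` the inverse projection is `φ (4 T z - 8 n) + n`. As `‖4 T z - 8 n‖² =
  -- 16 / φ`, all terms in `⟪z, v⟫ ⟪z, w⟫` cancel in the inner product of two derivatives.
  have heq : (fun z : E => (‖T z‖ ^ 2 + 4)⁻¹ • (4 : ℝ) • T z
      + (‖T z‖ ^ 2 + 4)⁻¹ • (‖T z‖ ^ 2 - 4) • n) =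
      fun z => (‖z‖ ^ 2 + 4)⁻¹ • ((4 : ℝ) • T z - (8 : ℝ) • n) + n := by
    funext z
    have := norm_sq_add_four_pos z
    rw [T.norm_map, smul_sub, smul_smul _ (8 : ℝ), smul_smul _ (‖z‖ ^ 2 - 4),
      show (‖z‖ ^ 2 + 4)⁻¹ * (‖z‖ ^ 2 - 4) = 1 - (‖z‖ ^ 2 + 4)⁻¹ * 8 by field_simp; ring]
    module
  rw [heq]
  have h := ((hasFDerivAt_inv_norm_sq_add_four z).smul
    ((T.toContinuousLinearMap.hasFDerivAt.const_smul (4 : ℝ)).sub_const ((8 : ℝ) • n))).add_const n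
  have h' : ∀ v, fderiv ℝ (fun z => (‖z‖ ^ 2 + 4)⁻¹ • ((4 : ℝ) • T z - (8 : ℝ) • n) + n) z v =
      (-(2 * ((‖z‖ ^ 2 + 4)⁻¹) ^ 2) * ⟪z, v⟫) • ((4 : ℝ) • T z - (8 : ℝ) • n)
        + (4 * (‖z‖ ^ 2 + 4)⁻¹) • T v := fun v => by
    refine (congrArg (fun L => L v) h.fderiv).trans ?_
    simp
    module
  rw [h', h', stereographicMetric_apply]
  simp only [inner_add_left, inner_add_right, inner_sub_left, inner_sub_right, inner_smul_left,
    inner_smul_right, conj_trivial, T.inner_map_map, hT, real_inner_comm (T _) n,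
    real_inner_self_eq_norm_sq, hn, real_inner_comm z v]
  have := norm_sq_add_four_pos z
  field_simp
  ring

variable [FiniteDimensional ℝ E]

theorem christoffel_stereographicMetric (z v w : E) :
    christoffel (stereographicMetric E) z v w =
      (-2 * (‖z‖ ^ 2 + 4)⁻¹) • (⟪z, v⟫ • w + ⟪z, w⟫ • v - ⟪v, w⟫ • z) := by
  refine christoffel_eq_of_forall (stereographicMetric_nondegenerate z) fun x => ?_
  simp only [christoffelFirst_apply, fderiv_stereographicMetric, stereographicMetric_apply,
    inner_smul_left, inner_add_left, inner_sub_left, conj_trivial]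
  ring

theorem fderiv_christoffel_stereographicMetric_zero (v w x : E) :
    fderiv ℝ (christoffel (stereographicMetric E)) 0 v w x =
      (-(1 / 2) : ℝ) • (⟪v, w⟫ • x + ⟪v, x⟫ • w - ⟪w, x⟫ • v) := by
  have hd : DifferentiableAt ℝ (christoffel (stereographicMetric E)) 0 :=
    (contDiffAt_christoffel contDiff_stereographicMetric.contDiffAt
      (isInvertible_of_nondegenerate (stereographicMetric_nondegenerate 0))).differentiableAt
      (by simp)
  rw [fderiv_clm_apply_apply₂ hd]
  simp only [christoffel_stereographicMetric]
  have hi : ∀ w : E, HasFDerivAt (fun z : E => ⟪z, w⟫) (innerSL ℝ w) 0 := fun w => by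
    have := (innerSL ℝ w).hasFDerivAt (x := (0 : E))
    refine this.congr_of_eventuallyEq (.of_forall fun z => ?_)
    simp [real_inner_comm]
  have h := ((hasFDerivAt_inv_norm_sq_add_four (0 : E)).const_mul (-2 : ℝ)).smul
    ((((hi w).smul_const x).add ((hi x).smul_const w)).sub
      ((hasFDerivAt_id (𝕜 := ℝ) (0 : E)).const_smul ⟪w, x⟫))
  refine (congrArg (fun L => L v) h.fderiv).trans ?_
  simp [real_inner_comm]
  module

/-- At the origin the Christoffel symbols vanish, so only their first derivatives contribute: `R(v,
w) x = ⟪w, x⟫ v - ⟪v, x⟫ w`, constant curvature one. -/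
theorem coordRicci_stereographicMetric_zero (w x : E) :
    coordRicci (stereographicMetric E) 0 w x = (Module.finrank ℝ E - 1) * ⟪w, x⟫ := by
  have h : (curvatureMap (stereographicMetric E) 0 w x : E →ₗ[ℝ] E) =
      ⟪w, x⟫ • LinearMap.id - (innerSL ℝ x : E →ₗ[ℝ] ℝ).smulRight w := by
    ext v
    simp [curvatureMap_apply, fderiv_christoffel_stereographicMetric_zero,
      christoffel_stereographicMetric, real_inner_comm]
    module
  rw [coordRicci, h]
  simp [LinearMap.trace_smulRight, real_inner_comm]
  ring

end SphericalCoordinates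

/-! ### The round two-sphere is Einstein. -/

section RoundSphere

open Filter Topology
open scoped RealInnerProductSpace

instance fact_finrank_euclideanSpace_three :
    Fact (Module.finrank ℝ (EuclideanSpace ℝ (Fin 3)) = 2 + 1) :=
  ⟨by simp⟩

theorem extChartAt_sphere_target (p : UnitSphere) : (extChartAt (𝓡 2) p).target = univ := by
  rw [extChartAt_target]
  have : (chartAt (EuclideanSpace ℝ (Fin 2)) p).target = univ := stereographic'_target (-p)
  rw [this]
  simp

/-- The preferred chart at `p` projects from the antipode `-p`. Thus the Ricci tensor at every point
is computed at the origin of the same coordinate metric. -/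
theorem extChartAt_sphere_self (p : UnitSphere) : extChartAt (𝓡 2) p p = 0 := by
  change stereographic' 2 (-p) p = 0
  simp only [stereographic', OpenPartialHomeomorph.coe_trans, Function.comp_apply]
  have h : stereographic (norm_eq_of_mem_sphere (-p)) p = 0 := by
    have := stereographic_neg_apply p
    exact this
  rw [h]
  exact map_zero (OrthonormalBasis.fromOrthogonalSpanSingleton 2
    (ne_zero_of_mem_unit_sphere (-p))).repr

theorem exists_extChartAt_sphere_symm (p : UnitSphere) :
    ∃ (T : EuclideanSpace ℝ (Fin 2) →ₗᵢ[ℝ] EuclideanSpace ℝ (Fin 3))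
      (n : EuclideanSpace ℝ (Fin 3)), ‖n‖ = 1 ∧ (∀ z, ⟪T z, n⟫ = 0) ∧
        ∀ z, ((extChartAt (𝓡 2) p).symm z : EuclideanSpace ℝ (Fin 3)) =
          (‖T z‖ ^ 2 + 4)⁻¹ • (4 : ℝ) • T z + (‖T z‖ ^ 2 + 4)⁻¹ • (‖T z‖ ^ 2 - 4) • n := by
  let W := (ℝ ∙ ((-p : UnitSphere) : EuclideanSpace ℝ (Fin 3)))ᗮ
  let R : W ≃ₗᵢ[ℝ] EuclideanSpace ℝ (Fin 2) := (OrthonormalBasis.fromOrthogonalSpanSingleton 2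
    (ne_zero_of_mem_unit_sphere (-p))).repr
  refine ⟨W.subtypeₗᵢ.comp R.symm.toLinearIsometry, ((-p : UnitSphere) : _),
    norm_eq_of_mem_sphere (-p), fun z => ?_, fun z => stereographic'_symm_apply (-p) z⟩
  exact (Submodule.mem_orthogonal_singleton_iff_inner_left.1 (R.symm z).2)

theorem coordForm_roundMetric (p : UnitSphere) :
    coordForm (𝓡 2) roundMetric p = stereographicMetric (EuclideanSpace ℝ (Fin 2)) := by
  obtain ⟨T, n, hn, hT, h⟩ := exists_extChartAt_sphere_symm p
  funext z
  refine ContinuousLinearMap.ext fun v => ContinuousLinearMap.ext fun w => ?_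
  rw [← inner_fderiv_stereographic_symm T hn hT]
  have hz : z ∈ (extChartAt (𝓡 2) p).target := by rw [extChartAt_sphere_target]; trivial
  have h1 : MDifferentiableAt (𝓡 2) 𝓘(ℝ, EuclideanSpace ℝ (Fin 3))
      (Subtype.val : UnitSphere → EuclideanSpace ℝ (Fin 3)) ((extChartAt (𝓡 2) p).symm z) :=
    (contMDiff_coe_sphere (m := 1) _).mdifferentiableAt (by simp)
  have h2 := mfderiv_comp z h1 (mdifferentiableAt_extChartAt_symm hz)
  rw [mfderiv_eq_fderiv] at h2
  have h3 : ((Subtype.val : UnitSphere → EuclideanSpace ℝ (Fin 3)) ∘ (extChartAt (𝓡 2) p).symm) =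
      fun z => (‖T z‖ ^ 2 + 4)⁻¹ • (4 : ℝ) • T z + (‖T z‖ ^ 2 + 4)⁻¹ • (‖T z‖ ^ 2 - 4) • n :=
    funext h
  rw [h3] at h2
  rw [h2]
  rfl

theorem roundMetric_apply (p : UnitSphere) (v w : EuclideanSpace ℝ (Fin 2)) :
    roundMetric p v w = ⟪v, w⟫ := by
  refine (coordForm_apply_self (I := 𝓡 2) roundMetric p v w).symm.trans ?_
  rw [coordForm_roundMetric, extChartAt_sphere_self, stereographicMetric_apply]
  norm_num

theorem isEinstein_roundMetric : IsEinstein (𝓡 2) roundMetric 1 := by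
  refine ⟨⟨fun p v w => ?_, fun p v hv => ?_, fun p => ?_⟩, fun p v w => ?_⟩
  · exact (roundMetric_apply p v w).trans
      ((real_inner_comm _ _).trans (roundMetric_apply p w v).symm)
  · have h : ∀ v : EuclideanSpace ℝ (Fin 2), ⟪v, v⟫ = 0 → v = 0 := fun v => inner_self_eq_zero.1
    exact h v ((roundMetric_apply p v v).symm.trans (hv v))
  · rw [coordForm_roundMetric]
    exact contDiff_stereographicMetric.contDiffOn
  · have h : ∀ v w : EuclideanSpace ℝ (Fin 2),
        coordRicci (stereographicMetric (EuclideanSpace ℝ (Fin 2))) 0 v w = 1 * ⟪v, w⟫ :=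
      fun v w => by
        rw [coordRicci_stereographicMetric_zero, finrank_euclideanSpace_fin]
        norm_num
    rw [ricci, coordForm_roundMetric, extChartAt_sphere_self]
    exact (h v w).trans (congrArg (1 * ·) (roundMetric_apply p v w)).symm

end RoundSphere

/-! ### The spherical families and the assembled theorem. -/

section Main

theorem profile_two (lam ν C r : ℝ) :
    profile 2 lam ν C r = -lam / 3 * r ^ 2 + ν + C / r := by
  have h1 : r ^ (1 + 2 / ((2 : ℕ) : ℝ)) = r ^ 2 := by norm_num
  have h2 : r ^ (1 - 2 / ((2 : ℕ) : ℝ)) = 1 := by norm_num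
  rw [profile, h1, h2]
  norm_num
  ring

/-- A family member with `k = 2`, `F = S²`, `ν = 1` and `u² = f`, in the coordinates `(s, y)` and
in the coordinates `(r, t)`. -/
theorem sphericalSchwarzschild {J : TopologicalSpace.Opens ℝ} (hJ0 : (J : Set ℝ) ⊆ Ioi 0)
    {f : ℝ → ℝ} (hf : ContDiffOn ℝ ∞ f J) (hf0 : ∀ r ∈ J, 0 < f r) {ε lam C : ℝ} (hε : ε ≠ 0)
    (h : ∀ r ∈ J, f r = -lam / 3 * r ^ 2 + 1 + C / r) :
    (∀ r ∈ J, √(f r) ^ 2 = profile 2 lam 1 C r) ∧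
      IsEinstein (prodModel 2) (generalizedSchwarzschild J ε (fun r => √(f r)) roundMetric) lam ∧
      ∃ Φ : (J × ℝ × UnitSphere) ≃ₘ^∞⟮prodModel 2, prodModel 2⟯ (sDomain J × ℝ × UnitSphere),
        (∀ r t x, ((Φ (r, t, x)).1 : ℝ) = (r : ℝ) ^ 2 ∧ (Φ (r, t, x)).2 = (t / 2, x)) ∧
        pullbackField (prodModel 2) (prodModel 2) Φ
            (generalizedSchwarzschild J ε (fun r => √(f r)) roundMetric) =
          arealMetric J ε f roundMetric := by
  have hprofile : ∀ r ∈ J, √(f r) ^ 2 = profile 2 lam 1 C r := fun r hr => by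
    rw [Real.sq_sqrt (hf0 r hr).le, profile_two, h r hr]
  -- Only the sufficiency half of the criterion is needed, and it asks for no connectedness of the
  -- domain.
  exact ⟨hprofile, isEinstein_generalizedSchwarzschild_of_profile le_rfl isEinstein_roundMetric
      (hf.sqrt fun r _ => (hf0 r ‹_›).ne') (fun r hr => Real.sqrt_pos.2 (hf0 r hr)) hε hprofile,
    arealDiffeomorph 2 UnitSphere hJ0, fun _ _ _ => ⟨rfl, rfl⟩,
    pullbackField_arealDiffeomorph hJ0 ε (fun r hr => Real.sqrt_pos.2 (hf0 r hr))
      (fun r hr => Real.sq_sqrt (hf0 r hr).le) roundMetric⟩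

theorem mainTheorem10 :
    -- the Einstein condition
    (∀ (k : ℕ), 2 ≤ k →
      ∀ (F : Type*) [TopologicalSpace F] [ChartedSpace (EuclideanSpace ℝ (Fin k)) F]
        [IsManifold (𝓡 k) ∞ F] [Nonempty F] (gF : BilinField (𝓡 k) F) (ν : ℝ),
        IsEinstein (𝓡 k) gF ν →
      ∀ (J : TopologicalSpace.Opens ℝ), (J : Set ℝ) ⊆ Ioi 0 → IsConnected (J : Set ℝ) →
      ∀ (u : ℝ → ℝ), ContDiffOn ℝ ∞ u J → (∀ r ∈ J, 0 < u r) →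
      ∀ (ε : ℝ), ε = 1 ∨ ε = -1 →
      ∀ (lam : ℝ),
        IsEinstein (prodModel k) (generalizedSchwarzschild J ε u gF) lam ↔
          ∃ C : ℝ, ∀ r ∈ J, u r ^ 2 = profile k lam ν C r) ∧
    -- for `k = 2`, the substitution `s = r²`, `y = t/2` gives `dr² / u² ± u² dt² + r² g_F`
    (∀ (F : Type*) [TopologicalSpace F] [ChartedSpace (EuclideanSpace ℝ (Fin 2)) F]
        [IsManifold (𝓡 2) ∞ F] (gF : BilinField (𝓡 2) F),
        IsPseudoRiemannian (𝓡 2) gF →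
      ∀ (J : TopologicalSpace.Opens ℝ), (J : Set ℝ) ⊆ Ioi 0 →
      ∀ (u : ℝ → ℝ), ContDiffOn ℝ ∞ u J → (∀ r ∈ J, 0 < u r) →
      ∀ (ε : ℝ), ε = 1 ∨ ε = -1 →
      ∃ Φ : (J × ℝ × F) ≃ₘ^∞⟮prodModel 2, prodModel 2⟯ (sDomain J × ℝ × F),
        (∀ (r : J) (t : ℝ) (x : F),
          ((Φ (r, t, x)).1 : ℝ) = (r : ℝ) ^ 2 ∧ (Φ (r, t, x)).2 = (t / 2, x)) ∧
        pullbackField (prodModel 2) (prodModel 2) Φ (generalizedSchwarzschild J ε u gF) =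
          arealMetric J ε (fun r => u r ^ 2) gF) ∧
    -- the Schwarzschild metric is the case `k = 2`, `F = S²`, `λ = 0`, `ν = 1`, `C = -2M`
    IsEinstein (𝓡 2) roundMetric 1 ∧
    (∀ M : ℝ, 0 ≤ M →
      (∀ r ∈ schwarzschildDomain M, √(1 - 2 * M / r) ^ 2 = profile 2 0 1 (-2 * M) r) ∧
      IsEinstein (prodModel 2) (generalizedSchwarzschild (schwarzschildDomain M) (-1)
        (fun r => √(1 - 2 * M / r)) roundMetric) 0 ∧
      ∃ Φ : (schwarzschildDomain M × ℝ × UnitSphere) ≃ₘ^∞⟮prodModel 2, prodModel 2⟯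
          (sDomain (schwarzschildDomain M) × ℝ × UnitSphere),
        (∀ r t x, ((Φ (r, t, x)).1 : ℝ) = (r : ℝ) ^ 2 ∧ (Φ (r, t, x)).2 = (t / 2, x)) ∧
        pullbackField (prodModel 2) (prodModel 2) Φ
            (generalizedSchwarzschild (schwarzschildDomain M) (-1)
              (fun r => √(1 - 2 * M / r)) roundMetric) =
          schwarzschildMetric M) ∧
    -- the Riemannian one is the case `k = 2`, `F = S²`, `λ = -3`, `ν = 1`, `C = -2m`
    (∀ m : ℝ, 0 < m →
      (∀ r ∈ riemannianSchwarzschildDomain m,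
        √(1 + r ^ 2 - 2 * m / r) ^ 2 = profile 2 (-3) 1 (-2 * m) r) ∧
      IsEinstein (prodModel 2) (generalizedSchwarzschild (riemannianSchwarzschildDomain m) 1
        (fun r => √(1 + r ^ 2 - 2 * m / r)) roundMetric) (-3) ∧
      ∃ Φ : (riemannianSchwarzschildDomain m × ℝ × UnitSphere) ≃ₘ^∞⟮prodModel 2, prodModel 2⟯
          (sDomain (riemannianSchwarzschildDomain m) × ℝ × UnitSphere),
        (∀ r t x, ((Φ (r, t, x)).1 : ℝ) = (r : ℝ) ^ 2 ∧ (Φ (r, t, x)).2 = (t / 2, x)) ∧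
        pullbackField (prodModel 2) (prodModel 2) Φ
            (generalizedSchwarzschild (riemannianSchwarzschildDomain m) 1
              (fun r => √(1 + r ^ 2 - 2 * m / r)) roundMetric) =
          riemannianSchwarzschildMetric m) := by
  refine ⟨?_, ?_, isEinstein_roundMetric, fun M _ => ?_, fun m _ => ?_⟩
  · intro k hk F _ _ _ _ gF ν hg J hJ0 hJ u hu hu0 ε hε lam
    have hε0 : ε ≠ 0 := by rcases hε with rfl | rfl <;> norm_num
    exact isEinstein_generalizedSchwarzschild_iff hk hg hJ0 hJ.isPreconnected hu hu0 hε0 lam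
  · intro F _ _ _ gF _ J hJ0 u _ hu0 ε _
    exact ⟨arealDiffeomorph 2 F hJ0, fun _ _ _ => ⟨rfl, rfl⟩,
      pullbackField_arealDiffeomorph hJ0 ε hu0 (fun _ _ => rfl) gF⟩
  · refine sphericalSchwarzschild (J := schwarzschildDomain M) (fun r hr => hr.1) ?_
      (fun r hr => hr.2) (by norm_num) fun r _ => by ring
    exact contDiffOn_const.sub (contDiffOn_const.div contDiffOn_id fun r hr => ne_of_gt hr.1)
  · refine sphericalSchwarzschild (J := riemannianSchwarzschildDomain m) (fun r hr => hr.1) ?_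
      (fun r hr => hr.2) (by norm_num) fun r _ => by ring
    exact (contDiffOn_const.add (contDiffOn_id.pow 2)).sub
      (contDiffOn_const.div contDiffOn_id fun r hr => ne_of_gt hr.1)

end Main

end
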